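/- Let $1<\alpha<2$, $T>0$, $\Omega=\{(x,y,t): 0\le x,y\le 1,\ 0\le t\le T\}$, and let $f=f(x,y,t)$, $\varphi=\varphi(x,y)$, $\psi=\psi(x,y)$ be given real functions. Consider the problem $$ {}_cD^{\alpha}_{0t}u = u_{xx}+\frac1x u_x+u_{yy}+f(x,y,t),\qquad {}_cD^{\alpha}_{0t}g(t)=\frac{1}{\Gamma(2-\alpha)}\int_0^t\frac{g''(s)\,ds}{(t-s)^{\alpha-1}}, $$ with boundary conditions $$\lim_{x\to0+}x\,u_x=0,\quad u(1,y,t)=0,\quad u(x,0,t)=0,\quad u(x,1,t)=0$$ and initial conditions $u(x,y,0)=\varphi(x,y)$, $u_t(x,y,0)=\psi(x,y)$. A *continuous solution* is a real function $u$, continuous on $\Omega$, such that $u_t$ exists and is continuous on $(0,1)^2\times[0,T)$ (a right-hand derivative at $t=0$); $u_x,u_{xx},u_{yy}$ exist and are continuous on $(0,1)^2\times(0,T)$; for every $(x,y)\in(0,1)^2$ the derivative $u_{tt}(x,y,\cdot)$ exists on $(0,T)$ and, for every $t\in(0,T)$, the integral defining ${}_cD^\alpha_{0t}u(x,y,t)$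 converges absolutely; the equation holds on $(0,1)^2\times(0,T)$; the limit condition at $x=0$ holds for all $y\in(0,1)$, $t\in(0,T)$; the other three boundary conditions and $u(x,y,0)=\varphi(x,y)$ hold on the corresponding faces of $\Omega$; and $u_t(x,y,0)=\psi(x,y)$ for all $(x,y)\in(0,1)^2$. Then the problem has at most one continuous solution: if $u$ and $v$ are continuous solutions for the same $f,\varphi,\psi$, then $u=v$ everywhere on $\Omega$. -/

import Mathlib

noncomputable section

namespace FractionalWave

/-- The closed space-time domain `0 ≤ x, y ≤ 1`, `0 ≤ t ≤ T`. -/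
def Omega (T : ℝ) : Set (ℝ × ℝ × ℝ) :=
  Set.Icc (0 : ℝ) 1 ×ˢ Set.Icc (0 : ℝ) 1 ×ˢ Set.Icc (0 : ℝ) T

/-- The open space-time domain `0 < x, y < 1`, `0 < t < T`. -/
def OmegaInt (T : ℝ) : Set (ℝ × ℝ × ℝ) :=
  Set.Ioo (0 : ℝ) 1 ×ˢ Set.Ioo (0 : ℝ) 1 ×ˢ Set.Ioo (0 : ℝ) T

/-- The open square together with the initial time: `0 < x, y < 1`, `0 ≤ t < T`. -/
def OmegaInit (T : ℝ) : Set (ℝ × ℝ × ℝ) :=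
  Set.Ioo (0 : ℝ) 1 ×ˢ Set.Ioo (0 : ℝ) 1 ×ˢ Set.Ico (0 : ℝ) T

/-- The integrand `g''(s) / (t - s) ^ (α - 1)` of the Caputo derivative, `1 < α < 2`. -/
def caputoIntegrand (α : ℝ) (g : ℝ → ℝ) (t s : ℝ) : ℝ :=
  deriv (deriv g) s / (t - s) ^ (α - 1)

/-- The Caputo derivative at `t` of order `α`, `1 < α < 2`, with base point `0`. -/
def caputo (α : ℝ) (g : ℝ → ℝ) (t : ℝ) : ℝ :=
  (1 / Real.Gamma (2 - α)) * ∫ s in (0 : ℝ)..t, caputoIntegrand α g t s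

/-- The Caputo derivative of `g` at `t` makes sense: `g` is twice differentiable on `(0, t)`
and the defining integral converges (as a Lebesgue integral). -/
def CaputoExists (α : ℝ) (g : ℝ → ℝ) (t : ℝ) : Prop :=
  (∀ s ∈ Set.Ioo (0 : ℝ) t, DifferentiableAt ℝ g s ∧ DifferentiableAt ℝ (deriv g) s) ∧
    IntervalIntegrable (caputoIntegrand α g t) MeasureTheory.volume 0 t

/-- `u_x`. -/
def dx (u : ℝ → ℝ → ℝ → ℝ) (x y t : ℝ) : ℝ := deriv (fun ξ => u ξ y t) x

/-- `u_xx`. -/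
def dxx (u : ℝ → ℝ → ℝ → ℝ) (x y t : ℝ) : ℝ := deriv (fun ξ => dx u ξ y t) x

/-- `u_y`. -/
def dy (u : ℝ → ℝ → ℝ → ℝ) (x y t : ℝ) : ℝ := deriv (fun η => u x η t) y

/-- `u_yy`. -/
def dyy (u : ℝ → ℝ → ℝ → ℝ) (x y t : ℝ) : ℝ := deriv (fun η => dy u x η t) y

/-- `u_t`, the right-hand derivative at `t = 0`. -/
def dt (u : ℝ → ℝ → ℝ → ℝ) (x y t : ℝ) : ℝ :=
  derivWithin (fun τ => u x y τ) (Set.Ici 0) t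

/-- `u` is a continuous (classical) solution, on `Omega T`, of
`cD^α u = u_xx + (1/x) u_x + u_yy + f` with the boundary conditions
`lim_{x → 0} x u_x = 0`, `u(1,y,t) = u(x,0,t) = u(x,1,t) = 0` and the initial conditions
`u(x,y,0) = φ(x,y)`, `u_t(x,y,0) = ψ(x,y)`. Only the values of `u` on `Omega T` matter. -/
structure IsContinuousSolution (α T : ℝ) (f : ℝ → ℝ → ℝ → ℝ) (φ ψ : ℝ → ℝ → ℝ)
    (u : ℝ → ℝ → ℝ → ℝ) : Prop where
  /-- `u` is continuous on the closed domain. -/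
  continuousOn : ContinuousOn (fun p : ℝ × ℝ × ℝ => u p.1 p.2.1 p.2.2) (Omega T)
  /-- `u_t` exists inside the square, up to the initial time. -/
  differentiable_t : ∀ x ∈ Set.Ioo (0 : ℝ) 1, ∀ y ∈ Set.Ioo (0 : ℝ) 1, ∀ t ∈ Set.Ico 0 T,
    DifferentiableWithinAt ℝ (fun τ => u x y τ) (Set.Ici 0) t
  /-- `u_t` is continuous inside the square, up to the initial time. -/
  continuousOn_dt :
    ContinuousOn (fun p : ℝ × ℝ × ℝ => dt u p.1 p.2.1 p.2.2) (OmegaInit T)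
  /-- `u` is twice differentiable in `x` inside the domain. -/
  differentiable_x : ∀ x ∈ Set.Ioo (0 : ℝ) 1, ∀ y ∈ Set.Ioo (0 : ℝ) 1, ∀ t ∈ Set.Ioo 0 T,
    DifferentiableAt ℝ (fun ξ => u ξ y t) x ∧ DifferentiableAt ℝ (fun ξ => dx u ξ y t) x
  /-- `u` is twice differentiable in `y` inside the domain. -/
  differentiable_y : ∀ x ∈ Set.Ioo (0 : ℝ) 1, ∀ y ∈ Set.Ioo (0 : ℝ) 1, ∀ t ∈ Set.Ioo 0 T,
    DifferentiableAt ℝ (fun η => u x η t) y ∧ DifferentiableAt ℝ (fun η => dy u x η t) y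
  /-- The spatial derivatives in the equation are continuous inside the domain. -/
  continuousOn_dx : ContinuousOn (fun p : ℝ × ℝ × ℝ => dx u p.1 p.2.1 p.2.2) (OmegaInt T)
  continuousOn_dxx : ContinuousOn (fun p : ℝ × ℝ × ℝ => dxx u p.1 p.2.1 p.2.2) (OmegaInt T)
  continuousOn_dyy : ContinuousOn (fun p : ℝ × ℝ × ℝ => dyy u p.1 p.2.1 p.2.2) (OmegaInt T)
  /-- The Caputo derivative in `t` exists inside the domain. -/
  caputoExists : ∀ x ∈ Set.Ioo (0 : ℝ) 1, ∀ y ∈ Set.Ioo (0 : ℝ) 1, ∀ t ∈ Set.Ioo 0 T,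
    CaputoExists α (fun τ => u x y τ) t
  /-- The differential equation. -/
  equation : ∀ x ∈ Set.Ioo (0 : ℝ) 1, ∀ y ∈ Set.Ioo (0 : ℝ) 1, ∀ t ∈ Set.Ioo 0 T,
    caputo α (fun τ => u x y τ) t =
      dxx u x y t + (1 / x) * dx u x y t + dyy u x y t + f x y t
  /-- The boundary condition at `x = 0`. -/
  boundary_x_zero : ∀ y ∈ Set.Ioo (0 : ℝ) 1, ∀ t ∈ Set.Ioo 0 T,
    Filter.Tendsto (fun x => x * dx u x y t) (nhdsWithin 0 (Set.Ioi 0)) (nhds 0)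
  /-- The boundary condition at `x = 1`. -/
  boundary_x_one : ∀ y ∈ Set.Icc (0 : ℝ) 1, ∀ t ∈ Set.Icc 0 T, u 1 y t = 0
  /-- The boundary condition at `y = 0`. -/
  boundary_y_zero : ∀ x ∈ Set.Icc (0 : ℝ) 1, ∀ t ∈ Set.Icc 0 T, u x 0 t = 0
  /-- The boundary condition at `y = 1`. -/
  boundary_y_one : ∀ x ∈ Set.Icc (0 : ℝ) 1, ∀ t ∈ Set.Icc 0 T, u x 1 t = 0
  /-- The initial value. -/
  initial_value : ∀ x ∈ Set.Icc (0 : ℝ) 1, ∀ y ∈ Set.Icc (0 : ℝ) 1, u x y 0 = φ x y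
  /-- The initial velocity. -/
  initial_velocity : ∀ x ∈ Set.Ioo (0 : ℝ) 1, ∀ y ∈ Set.Ioo (0 : ℝ) 1, dt u x y 0 = ψ x y

end FractionalWave

end

/-! The difference w of two solutions solves the homogeneous problem with zero data. Formally, its
coefficient a(t) against a product of spatial eigenfunctions solves a fractional ODE with zero data,
hence vanishes. Since w need not be regular up to the boundary of the square, the argument uses
Green functions and an equation free of derivatives of w.

The weight x turns u_xx + u_x/x into (x u_x)', whose scale function is log; in y the scale function
is the identity. On a rectangle strictly inside the square, testing against the product of the two
Green functions removes every space derivative (`integral_green_mul`). In time, w_t = 0 at t = 0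
makes the integrated Caputo derivative an Abel integral of w_t (`integral_caputo`), and
`abel_inversion` recovers w from it, with the bounded kernel (t - s)^(α - 1) on the other side. The
result is `rectangle_identity`. When the rectangle fills the square (`square_identity`), the
boundary terms on three sides vanish with w, and the one at x = 0 carries a coefficient of order
1/|log ε| against a bounded function.

For ω = √x w the kernel in x becomes symmetric, and with P, Q the integral operators in x and y,
`kernel_identity` reads P Q ω(t) = C ∫₀ᵗ (t - s)^(α - 1) (Q ω(s) + P ω(s)) ds. Pairing with
eigenfunctions of P and Q, with eigenvalues c and d, gives c d a(t) = C (c + d) ∫₀ᵗ (t - s)^(α - 1)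
a(s) ds. Both operators are injective, because their ranges contain all weighted test functions
(`ae_eq_zero_of_range_testFunction`), so c d ≠ 0 and Grönwall gives a = 0. The spectral theorem for
compact symmetric operators makes the eigenfunctions complete, whence ω = 0
(`eq_zero_of_kernel_identity`). -/

open MeasureTheory Set Filter Topology

namespace FractionalWave

/-! ### Fractional integrals, Abel inversion and the Caputo derivative -/

section Abel

/-- Associativity of Volterra convolutions on `(0, t)`. -/
theorem volterra_assoc {k₁ k₂ f : ℝ → ℝ} (hk₁ : Measurable k₁) (hk₂ : Measurable k₂) {t C : ℝ}
    (ht : 0 ≤ t) (hf : IntervalIntegrable f volume 0 t)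
    (hint : ∀ r ∈ Ioo 0 t, IntegrableOn (fun s => k₁ (t - s) * k₂ (s - r)) (Ioo r t))
    (hC : ∀ r ∈ Ioo 0 t, ∫ s in Ioo r t, ‖k₁ (t - s) * k₂ (s - r)‖ ≤ C) :
    IntervalIntegrable (fun s => k₁ (t - s) * ∫ r in (0 : ℝ)..s, k₂ (s - r) * f r) volume 0 t ∧
    ∫ s in (0 : ℝ)..t, k₁ (t - s) * (∫ r in (0 : ℝ)..s, k₂ (s - r) * f r) =
      ∫ r in (0 : ℝ)..t, (∫ s in Ioo r t, k₁ (t - s) * k₂ (s - r)) * f r := by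
  set m : Measure ℝ := volume.restrict (Ioo 0 t) with hm
  have hfm : Integrable f m := (intervalIntegrable_iff_integrableOn_Ioo_of_le ht).1 hf
  -- Extension by zero off the triangle r < s makes this an integral over the fixed square (0, t)²,
  -- where Fubini applies. Integrating in s first, the norm is dominated by C ‖f r‖.
  set G : ℝ → ℝ → ℝ := fun r s => {p : ℝ × ℝ | p.1 < p.2}.indicator
    (fun p => k₁ (t - p.2) * k₂ (p.2 - p.1) * f p.1) (r, s) with hG
  have hset : MeasurableSet {p : ℝ × ℝ | p.1 < p.2} := measurableSet_lt measurable_fst measurable_snd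
  have hGr (r : ℝ) : G r = (Ioi r).indicator (fun s => k₁ (t - s) * k₂ (s - r) * f r) := by
    ext s; simp [hG, indicator]
  have hGs (s : ℝ) : (fun r => G r s) =
      (Iio s).indicator (fun r => k₁ (t - s) * k₂ (s - r) * f r) := by
    ext r; simp [hG, indicator]
  have hrr : ∀ r ∈ Ioo 0 t, m.restrict (Ioi r) = volume.restrict (Ioo r t) := fun r hr => by
    rw [hm, Measure.restrict_restrict measurableSet_Ioi]
    congr 1; ext s; simp only [mem_inter_iff, mem_Ioi, mem_Ioo]
    exact ⟨fun h => ⟨h.1, h.2.2⟩, fun h => ⟨h.1, hr.1.trans h.1, h.2⟩⟩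
  have hrs : ∀ s ∈ Ioo 0 t, m.restrict (Iio s) = volume.restrict (Ioo 0 s) := fun s hs => by
    rw [hm, Measure.restrict_restrict measurableSet_Iio]
    congr 1; ext r; simp only [mem_inter_iff, mem_Iio, mem_Ioo]
    exact ⟨fun h => ⟨h.2.1, h.1⟩, fun h => ⟨h.2, h.1, h.2.trans hs.2⟩⟩
  have hmem : ∀ᵐ r ∂m, r ∈ Ioo 0 t := ae_restrict_mem measurableSet_Ioo
  have hGm : AEStronglyMeasurable (Function.uncurry G) (m.prod m) := by
    have h1 : AEStronglyMeasurable (fun p : ℝ × ℝ => k₁ (t - p.2) * k₂ (p.2 - p.1) * f p.1)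
        (m.prod m) :=
      (Measurable.aestronglyMeasurable (by fun_prop)).mul hfm.aestronglyMeasurable.comp_fst
    exact h1.indicator hset
  have hGi : Integrable (Function.uncurry G) (m.prod m) := by
    rw [integrable_prod_iff hGm]
    constructor
    · filter_upwards [hmem] with r hr
      change Integrable (G r) m
      rw [hGr, integrable_indicator_iff measurableSet_Ioi, IntegrableOn, hrr r hr]
      exact (hint r hr).mul_const _
    · refine (hfm.norm.const_mul C).mono' hGm.norm.integral_prod_right' ?_
      filter_upwards [hmem] with r hr
      change ‖∫ s, ‖G r s‖ ∂m‖ ≤ _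
      rw [Real.norm_of_nonneg (integral_nonneg fun _ => norm_nonneg _)]
      simp_rw [hGr r, norm_indicator_eq_indicator_norm]
      rw [integral_indicator measurableSet_Ioi, hrr r hr]
      simp_rw [norm_mul _ (f r), integral_mul_const]
      exact mul_le_mul_of_nonneg_right (hC r hr) (norm_nonneg _)
  have hin : ∀ᵐ s ∂m, ∫ r, G r s ∂m = k₁ (t - s) * ∫ r in (0 : ℝ)..s, k₂ (s - r) * f r := by
    filter_upwards [hmem] with s hs
    rw [hGs, integral_indicator measurableSet_Iio, hrs s hs,
      intervalIntegral.integral_of_le hs.1.le, integral_Ioc_eq_integral_Ioo]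
    simp_rw [mul_assoc, integral_const_mul]
  refine ⟨?_, ?_⟩
  · rw [intervalIntegrable_iff_integrableOn_Ioo_of_le ht]
    exact hGi.integral_prod_right.congr hin
  · simp_rw [intervalIntegral.integral_of_le ht, integral_Ioc_eq_integral_Ioo]
    rw [← integral_congr_ae hin, ← integral_integral_swap hGi]
    refine integral_congr_ae ?_
    filter_upwards [hmem] with r hr
    rw [hGr, integral_indicator measurableSet_Ioi, hrr r hr, integral_mul_const]

/-- The Euler beta integral, with shifted parameters. -/
noncomputable def betaConst (a b : ℝ) : ℝ := ∫ z in (0 : ℝ)..1, (1 - z) ^ a * z ^ b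

theorem intervalIntegrable_rpow_mul_rpow {a b r t : ℝ} (ha : -1 < a) (hb : -1 < b) (hrt : r < t) :
    IntervalIntegrable (fun s => (t - s) ^ a * (s - r) ^ b) volume r t := by
  -- Splitting at the midpoint leaves one singular factor on each half.
  set c := (r + t) / 2
  have h1 : r < c := by simp only [c]; linarith
  have h2 : c < t := by simp only [c]; linarith
  refine IntervalIntegrable.trans (b := c) ?_ ?_
  · have := (intervalIntegral.intervalIntegrable_rpow' (a := 0) (b := c - r) hb).comp_sub_right r
    simp only [zero_add, sub_add_cancel] at this
    refine this.continuousOn_mul ?_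
    refine ContinuousOn.rpow_const (by fun_prop) fun s hs => Or.inl ?_
    rw [uIcc_of_le h1.le] at hs
    linarith [hs.2]
  · have := (intervalIntegral.intervalIntegrable_rpow' (a := t - c) (b := 0) ha).comp_sub_left t
    simp only [sub_zero, sub_sub_cancel] at this
    refine this.mul_continuousOn ?_
    refine ContinuousOn.rpow_const (by fun_prop) fun s hs => Or.inl ?_
    rw [uIcc_of_le h2.le] at hs
    linarith [hs.1]

theorem integral_rpow_mul_rpow (a b : ℝ) {r t : ℝ} (hrt : r < t) :
    ∫ s in r..t, (t - s) ^ a * (s - r) ^ b = betaConst a b * (t - r) ^ (a + b + 1) := by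
  have hpos : 0 < t - r := sub_pos.2 hrt
  have h := intervalIntegral.smul_integral_comp_add_mul (a := 0) (b := 1)
    (fun s => (t - s) ^ a * (s - r) ^ b) (t - r) r
  simp only [mul_zero, add_zero, mul_one, add_sub_cancel] at h
  rw [← h, betaConst, smul_eq_mul, mul_comm, ← intervalIntegral.integral_mul_const,
    ← intervalIntegral.integral_mul_const]
  refine intervalIntegral.integral_congr fun z hz => ?_
  rw [uIcc_of_le zero_le_one] at hz
  rw [show t - (r + (t - r) * z) = (t - r) * (1 - z) by ring,
    show r + (t - r) * z - r = (t - r) * z by ring, Real.mul_rpow hpos.le (by linarith [hz.2]),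
    Real.mul_rpow hpos.le hz.1, Real.rpow_add hpos, Real.rpow_add hpos, Real.rpow_one]
  ring

theorem betaConst_comm (a b : ℝ) : betaConst a b = betaConst b a := by
  have := intervalIntegral.integral_comp_sub_left (a := 0) (b := 1)
    (fun z : ℝ => (1 - z) ^ a * z ^ b) 1
  simp only [sub_zero, sub_self, sub_sub_cancel] at this
  rw [betaConst, betaConst, ← this]
  simp_rw [mul_comm]

theorem betaConst_pos {a b : ℝ} (ha : -1 < a) (hb : -1 < b) : 0 < betaConst a b := by
  refine intervalIntegral.intervalIntegral_pos_of_pos_on ?_ (fun z hz => ?_) one_pos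
  · simpa using intervalIntegrable_rpow_mul_rpow ha hb (zero_lt_one' ℝ)
  · exact mul_pos (Real.rpow_pos_of_pos (by linarith [hz.2]) _) (Real.rpow_pos_of_pos hz.1 _)

/-- The semigroup law for fractional integrals. -/
theorem rpow_volterra_assoc {a b t : ℝ} (ha : -1 < a) (hb : -1 < b) (hab : 0 ≤ a + b + 1)
    (ht : 0 ≤ t) {f : ℝ → ℝ} (hf : IntervalIntegrable f volume 0 t) :
    IntervalIntegrable (fun s => (t - s) ^ a * ∫ r in (0 : ℝ)..s, (s - r) ^ b * f r) volume 0 t ∧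
    ∫ s in (0 : ℝ)..t, (t - s) ^ a * (∫ r in (0 : ℝ)..s, (s - r) ^ b * f r) =
      betaConst a b * ∫ r in (0 : ℝ)..t, (t - r) ^ (a + b + 1) * f r := by
  have hval : ∀ r ∈ Ioo 0 t, ∫ s in Ioo r t, (t - s) ^ a * (s - r) ^ b =
      betaConst a b * (t - r) ^ (a + b + 1) := fun r hr => by
    rw [← integral_rpow_mul_rpow a b hr.2, intervalIntegral.integral_of_le hr.2.le,
      integral_Ioc_eq_integral_Ioo]
  -- The uniform bound uses 0 ≤ a + b + 1: then (t - r) ^ (a + b + 1) is at most t ^ (a + b + 1).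
  have h := volterra_assoc (k₁ := fun z => z ^ a) (k₂ := fun z => z ^ b) (f := f) (t := t)
    (C := betaConst a b * t ^ (a + b + 1)) (by fun_prop) (by fun_prop) ht hf
    (fun r hr => (intervalIntegrable_iff_integrableOn_Ioo_of_le hr.2.le).1
      (intervalIntegrable_rpow_mul_rpow ha hb hr.2))
    (fun r hr => by
      have : ∫ s in Ioo r t, ‖(t - s) ^ a * (s - r) ^ b‖ =
          ∫ s in Ioo r t, (t - s) ^ a * (s - r) ^ b := by
        refine setIntegral_congr_fun measurableSet_Ioo fun s hs => Real.norm_of_nonneg ?_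
        exact mul_nonneg (Real.rpow_nonneg (by linarith [hs.2]) _)
          (Real.rpow_nonneg (by linarith [hs.1]) _)
      rw [this, hval r hr]
      refine mul_le_mul_of_nonneg_left ?_ (betaConst_pos ha hb).le
      exact Real.rpow_le_rpow (by linarith [hr.2]) (by linarith [hr.1]) hab)
  refine ⟨h.1, h.2.trans ?_⟩
  rw [← intervalIntegral.integral_const_mul, intervalIntegral.integral_of_le ht,
    intervalIntegral.integral_of_le ht, integral_Ioc_eq_integral_Ioo, integral_Ioc_eq_integral_Ioo]
  refine setIntegral_congr_fun measurableSet_Ioo fun r hr => ?_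
  rw [hval r hr, mul_assoc]

/-- Inversion of an Abel integral equation. -/
theorem abel_inversion {α t c : ℝ} (hα₁ : 1 < α) (hα₂ : α < 2) (ht : 0 ≤ t) {d r : ℝ → ℝ}
    (hd : IntervalIntegrable d volume 0 t) (hr : IntervalIntegrable r volume 0 t)
    (h : ∀ s ∈ Ioo 0 t, c * ∫ σ in (0 : ℝ)..s, (s - σ) ^ (1 - α) * d σ = ∫ σ in (0 : ℝ)..s, r σ) :
    c * betaConst (α - 2) (1 - α) * ∫ σ in (0 : ℝ)..t, d σ =
      betaConst (α - 2) 0 * ∫ σ in (0 : ℝ)..t, (t - σ) ^ (α - 1) * r σ := by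
  -- Both sides of the hypothesis are convolved with z ^ (α - 2). The exponents α - 2 and 1 - α
  -- compose to 0, so the left side becomes a plain integral of d; on the right, the exponent 0 of
  -- the ordinary primitive becomes α - 1.
  have h1 := (rpow_volterra_assoc (a := α - 2) (b := 1 - α) (by linarith) (by linarith)
    (by linarith) ht hd).2
  have h2 := (rpow_volterra_assoc (a := α - 2) (b := 0) (by linarith) (by linarith)
    (by linarith) ht hr).2
  simp only [show α - 2 + (1 - α) + 1 = 0 by ring, show α - 2 + 0 + 1 = α - 1 by ring,
    Real.rpow_zero, one_mul] at h1 h2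
  rw [← h2, mul_assoc, ← h1, ← intervalIntegral.integral_const_mul,
    intervalIntegral.integral_of_le ht, intervalIntegral.integral_of_le ht,
    integral_Ioc_eq_integral_Ioo, integral_Ioc_eq_integral_Ioo]
  refine setIntegral_congr_fun measurableSet_Ioo fun s hs => ?_
  rw [← h s hs]; ring

theorem caputoIntegrand_eq (α : ℝ) (g : ℝ → ℝ) {t s : ℝ} (hst : s ≤ t) :
    caputoIntegrand α g t s = (t - s) ^ (1 - α) * deriv (deriv g) s := by
  rw [caputoIntegrand, show 1 - α = -(α - 1) by ring, Real.rpow_neg (by linarith),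
    div_eq_inv_mul]

theorem caputo_eq (α : ℝ) (g : ℝ → ℝ) {t : ℝ} (ht : 0 ≤ t) :
    caputo α g t = 1 / Real.Gamma (2 - α) *
      ∫ s in (0 : ℝ)..t, (t - s) ^ (1 - α) * deriv (deriv g) s := by
  rw [caputo]
  congr 1
  refine intervalIntegral.integral_congr fun s hs => ?_
  rw [uIcc_of_le ht] at hs
  exact caputoIntegrand_eq α g hs.2

/-- The integral of the Caputo derivative of order `α` of `g` is the Caputo derivative of order
`α - 1`, when `g'(0) = 0`. -/
theorem integral_caputo {α T : ℝ} (hα₁ : 1 < α) (hα₂ : α < 2) {g : ℝ → ℝ}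
    (hcont : ContinuousOn (derivWithin g (Ici 0)) (Ico 0 T)) (h0 : derivWithin g (Ici 0) 0 = 0)
    (hC : ∀ t ∈ Ioo 0 T, CaputoExists α g t) {t : ℝ} (ht : t ∈ Ioo 0 T) :
    IntervalIntegrable (caputo α g) volume 0 t ∧
      ∫ s in (0 : ℝ)..t, caputo α g s =
        1 / Real.Gamma (2 - α) *
          ∫ s in (0 : ℝ)..t, (t - s) ^ (1 - α) * derivWithin g (Ici 0) s := by
  have hint : IntervalIntegrable (deriv (deriv g)) volume 0 t := by
    -- Multiplying by the continuous factor (t - s) ^ (α - 1) cancels the weight, so g'' itself is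
    -- integrable up to 0.
    have h1 : IntervalIntegrable (fun s => (t - s) ^ (α - 1) * caputoIntegrand α g t s)
        volume 0 t := by
      refine (hC t ht).2.continuousOn_mul ?_
      exact (ContinuousOn.rpow_const (by fun_prop) fun s hs => Or.inr (by linarith))
    rw [intervalIntegrable_iff_integrableOn_Ioo_of_le ht.1.le] at h1 ⊢
    refine h1.congr_fun (fun s hs => ?_) measurableSet_Ioo
    have : 0 < t - s := by linarith [hs.2]
    simp only [caputoIntegrand]
    field_simp
  have heq : ∀ s ∈ Ioi (0 : ℝ), derivWithin g (Ici 0) s = deriv g s := fun s hs =>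
    derivWithin_of_mem_nhds (Ici_mem_nhds hs)
  have hftc : ∀ s ∈ Ioo 0 t, derivWithin g (Ici 0) s = ∫ r in (0 : ℝ)..s, deriv (deriv g) r := by
    intro s hs
    rw [intervalIntegral.integral_eq_sub_of_hasDerivAt_of_le (f := derivWithin g (Ici 0)) hs.1.le,
      h0, sub_zero]
    · exact hcont.mono fun r hr => ⟨hr.1, hr.2.trans_lt (hs.2.trans ht.2)⟩
    · intro r hr
      have h1 := ((hC t ht).1 r ⟨hr.1, hr.2.trans hs.2⟩).2.hasDerivAt
      refine h1.congr_of_eventuallyEq ?_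
      filter_upwards [Ioi_mem_nhds hr.1] with z hz using heq z hz
    · exact hint.mono_set (by
        rw [uIcc_of_le hs.1.le, uIcc_of_le ht.1.le]; exact Icc_subset_Icc_right hs.2.le)
  -- Fractional integrals commute: both orders of composition give the kernel (t - r) ^ (2 - α),
  -- with constants equal by `betaConst_comm`. In one order the inner integral is the Caputo
  -- derivative, in the other it is g', by `hftc`.
  have A := rpow_volterra_assoc (a := 0) (b := 1 - α) (by linarith) (by linarith)
    (by linarith) ht.1.le hint
  have B := rpow_volterra_assoc (a := 1 - α) (b := 0) (by linarith) (by linarith)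
    (by linarith) ht.1.le hint
  simp only [Real.rpow_zero, one_mul] at A B
  constructor
  · refine (A.1.const_mul (1 / Real.Gamma (2 - α))).congr fun s hs => ?_
    rw [uIoc_of_le ht.1.le] at hs
    exact (caputo_eq α g hs.1.le).symm
  · rw [intervalIntegral.integral_congr (g := fun s => 1 / Real.Gamma (2 - α) *
      ∫ r in (0 : ℝ)..s, (s - r) ^ (1 - α) * deriv (deriv g) r),
      intervalIntegral.integral_const_mul, A.2, betaConst_comm, zero_add]
    · rw [add_zero] at B
      rw [← B.2, intervalIntegral.integral_of_le ht.1.le, intervalIntegral.integral_of_le ht.1.le,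
        integral_Ioc_eq_integral_Ioo, integral_Ioc_eq_integral_Ioo]
      congr 1
      refine setIntegral_congr_fun measurableSet_Ioo fun s hs => ?_
      rw [hftc s hs]
    · intro s hs
      rw [uIcc_of_le ht.1.le] at hs
      exact caputo_eq α g hs.1

end Abel

/-! ### Compact symmetric integral operators with continuous kernel -/

section Spectral

variable {X : Type*} [MetricSpace X] [CompactSpace X]

/-- The operator sending `f` to the continuous function `x ↦ ⟪κ x, f⟫`. -/
noncomputable def pairingOperator {H : Type*} [NormedAddCommGroup H] [InnerProductSpace ℝ H] (κ : C(X, H)) :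
    H →L[ℝ] BoundedContinuousFunction X ℝ :=
  LinearMap.mkContinuous
    { toFun := fun f => BoundedContinuousFunction.mkOfCompact
        ⟨fun x => inner ℝ (κ x) f, by fun_prop⟩
      map_add' := fun f g => by ext x; simp [inner_add_right]
      map_smul' := fun c f => by ext x; simp [inner_smul_right] } ‖κ‖ (by
    intro f
    refine (BoundedContinuousFunction.norm_le (by positivity)).2 fun x => ?_
    exact (norm_inner_le_norm _ _).trans
      (mul_le_mul_of_nonneg_right (κ.norm_coe_le_norm x) (norm_nonneg _)))

theorem pairingOperator_apply {H : Type*} [NormedAddCommGroup H] [InnerProductSpace ℝ H]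
    (κ : C(X, H)) (f : H) (x : X) : pairingOperator κ f x = inner ℝ (κ x) f := rfl

/-- Arzelà–Ascoli: the image of the unit ball is bounded by ‖κ‖, and equicontinuous because ⟪κ x - κ
x₀, f⟫ is at most ‖κ x - κ x₀‖ there. -/
theorem isCompactOperator_pairingOperator {H : Type*} [NormedAddCommGroup H]
    [InnerProductSpace ℝ H] (κ : C(X, H)) : IsCompactOperator (pairingOperator κ) := by
  have := isCompactOperator_iff_isCompact_closure_image_closedBall
    ((pairingOperator κ : H →L[ℝ] BoundedContinuousFunction X ℝ) :
      H →ₗ[ℝ] BoundedContinuousFunction X ℝ) (r := 1) one_pos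
  refine this.2 ?_
  refine BoundedContinuousFunction.arzela_ascoli (Metric.closedBall (0 : ℝ) ‖κ‖)
    (isCompact_closedBall _ _) _ ?_ ?_
  · rintro _ x ⟨f, hf, rfl⟩
    simp only [Metric.mem_closedBall, dist_zero_right] at hf ⊢
    calc _ ≤ ‖κ x‖ * ‖f‖ := norm_inner_le_norm _ _
      _ ≤ ‖κ‖ * 1 := mul_le_mul (κ.norm_coe_le_norm x) hf (norm_nonneg _) (norm_nonneg _)
      _ = ‖κ‖ := mul_one _
  · intro x₀
    rw [Metric.equicontinuousAt_iff_right]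
    intro ε hε
    filter_upwards [Metric.continuousAt_iff'.1 κ.continuous.continuousAt ε hε] with x hx
    rintro ⟨_, f, hf, rfl⟩
    simp only [Metric.mem_closedBall, dist_zero_right] at hf
    change dist (inner ℝ (κ x₀) f) (inner ℝ (κ x) f) < ε
    rw [dist_comm, Real.dist_eq, ← inner_sub_left]
    calc _ ≤ ‖κ x - κ x₀‖ * ‖f‖ := abs_real_inner_le_norm _ _
      _ ≤ ‖κ x - κ x₀‖ * 1 := by gcongr
      _ < ε := by rwa [mul_one, ← dist_eq_norm]

variable [MeasurableSpace X] [BorelSpace X] {μ : Measure X} [IsFiniteMeasure μ]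

/-- The function `x ↦ k x` with values in `L²`. -/
noncomputable def kernelSection (μ : Measure X) [IsFiniteMeasure μ] (k : C(X × X, ℝ)) : C(X, Lp ℝ 2 μ) :=
  ⟨fun x => ContinuousMap.toLp 2 μ ℝ (k.curry x), by fun_prop⟩

/-- The integral operator on `L²` with a continuous kernel. -/
noncomputable def kernelOperator (μ : Measure X) [IsFiniteMeasure μ] (k : C(X × X, ℝ)) :
    Lp ℝ 2 μ →L[ℝ] Lp ℝ 2 μ :=
  (BoundedContinuousFunction.toLp 2 μ ℝ).comp (pairingOperator (kernelSection μ k))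

theorem pairingOperator_kernelSection (k : C(X × X, ℝ)) (f : Lp ℝ 2 μ) (x : X) :
    pairingOperator (kernelSection μ k) f x = ∫ ξ, k (x, ξ) * f ξ ∂μ := by
  rw [pairingOperator_apply, L2.inner_def]
  refine integral_congr_ae ?_
  filter_upwards [ContinuousMap.coeFn_toLp (p := 2) (𝕜 := ℝ) μ (k.curry x)] with ξ hξ
  change inner ℝ ((ContinuousMap.toLp 2 μ ℝ (k.curry x) : Lp ℝ 2 μ) ξ) (f ξ) = _
  rw [hξ]
  simp [mul_comm]

theorem kernelOperator_apply_ae (k : C(X × X, ℝ)) (f : Lp ℝ 2 μ) :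
    kernelOperator μ k f =ᵐ[μ] fun x => ∫ ξ, k (x, ξ) * f ξ ∂μ := by
  filter_upwards [BoundedContinuousFunction.coeFn_toLp (p := 2) (𝕜 := ℝ) μ
    (pairingOperator (kernelSection μ k) f)] with x hx
  rw [← pairingOperator_kernelSection, ← hx]
  rfl

theorem isCompactOperator_kernelOperator (k : C(X × X, ℝ)) :
    IsCompactOperator (kernelOperator μ k) :=
  (isCompactOperator_pairingOperator (kernelSection μ k)).clm_comp
    (BoundedContinuousFunction.toLp 2 μ ℝ)

/-- Fubini and symmetry. Integrability of both functions is enough, which matters when one of them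
is a preimage of a test function not known to be in L². -/
theorem integral_kernel_comm {k : X → X → ℝ} (hk : Continuous fun p : X × X => k p.1 p.2)
    (hsymm : ∀ x y, k x y = k y x) {e f : X → ℝ} (he : Integrable e μ) (hf : Integrable f μ) :
    ∫ x, f x * ∫ ξ, k x ξ * e ξ ∂μ ∂μ = ∫ x, e x * ∫ ξ, k x ξ * f ξ ∂μ ∂μ := by
  simp_rw [← integral_const_mul]
  rw [integral_integral_swap]
  · congr! 4 with x ξ
    rw [hsymm]; ring
  · obtain ⟨M, hM⟩ := isCompact_univ.exists_bound_of_continuousOn hk.continuousOn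
    have := (hf.mul_prod he).mul_bdd (c := M) hk.aestronglyMeasurable
      (Eventually.of_forall fun p => hM p (mem_univ _))
    refine this.congr (Eventually.of_forall fun p => ?_)
    simp only [Function.uncurry]; ring

theorem isSymmetric_kernelOperator (k : C(X × X, ℝ)) (hsymm : ∀ x y, k (x, y) = k (y, x)) :
    (kernelOperator μ k : Lp ℝ 2 μ →ₗ[ℝ] Lp ℝ 2 μ).IsSymmetric := by
  intro e f
  have hint (g : Lp ℝ 2 μ) : Integrable g μ := (Lp.memLp g).integrable one_le_two
  rw [L2.inner_def, L2.inner_def]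
  trans ∫ x, f x * ∫ ξ, k (x, ξ) * e ξ ∂μ ∂μ
  · refine integral_congr_ae ?_
    filter_upwards [kernelOperator_apply_ae k e] with x hx
    simp only [RCLike.inner_apply, conj_trivial]
    rw [← hx]; rfl
  · rw [integral_kernel_comm (k := fun x y => k (x, y)) (by fun_prop) hsymm (hint e) (hint f)]
    refine integral_congr_ae ?_
    filter_upwards [kernelOperator_apply_ae k f] with x hx
    simp only [RCLike.inner_apply, conj_trivial]
    rw [← hx, mul_comm]; rfl

/-- A continuous function orthogonal to all eigenfunctions of a symmetric continuous kernel
vanishes almost everywhere. -/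
theorem ae_eq_zero_of_forall_eigenfunction {k : X → X → ℝ}
    (hk : Continuous fun p : X × X => k p.1 p.2) (hsymm : ∀ x y, k x y = k y x)
    {f : X → ℝ} (hf : Continuous f)
    (h : ∀ (e : X → ℝ) (c : ℝ), MemLp e 2 μ → (∀ᵐ x ∂μ, ∫ ξ, k x ξ * e ξ ∂μ = c * e x) →
      ∫ x, e x * f x ∂μ = 0) : f =ᵐ[μ] 0 := by
  set K : C(X × X, ℝ) := ⟨fun p => k p.1 p.2, hk⟩
  -- The supremum runs over all real c, so the null space of the operator (c = 0) is included.
  have hbot := ContinuousLinearMap.orthogonalComplement_iSup_eigenspaces_eq_bot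
    (isCompactOperator_kernelOperator (μ := μ) K) (isSymmetric_kernelOperator K hsymm)
  set F : Lp ℝ 2 μ := ContinuousMap.toLp 2 μ ℝ ⟨f, hf⟩
  have hF : F =ᵐ[μ] f := ContinuousMap.coeFn_toLp μ _
  have hmem : F ∈ (⨆ c, Module.End.eigenspace
      (kernelOperator μ K : Lp ℝ 2 μ →ₗ[ℝ] Lp ℝ 2 μ) c)ᗮ := by
    rw [← Submodule.iInf_orthogonal]
    simp only [Submodule.mem_iInf]
    intro c
    rw [Submodule.mem_orthogonal]
    intro e he
    rw [Module.End.mem_eigenspace_iff] at he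
    rw [L2.inner_def, ← h e c (Lp.memLp e)]
    · refine integral_congr_ae ?_
      filter_upwards [hF] with x hx
      simp [hx, mul_comm]
    · have he' : kernelOperator μ K e = c • e := he
      filter_upwards [kernelOperator_apply_ae K e, Lp.coeFn_smul c e] with x h1 h2
      rw [he', h2] at h1
      exact h1.symm
  have h0 : F = 0 := by
    have h1 := hbot ▸ hmem
    simpa using h1
  filter_upwards [hF, h0 ▸ Lp.coeFn_zero ℝ 2 μ] with x h1 h2
  rw [← h1]
  exact h2

end Spectral

/-! ### Projection onto eigenfunctions and vanishing of the coefficients -/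

section Projection

/-- Fubini for an integrable weight against a bounded function of two variables. -/
theorem integral_integral_swap_of_bounded {X Y : Type*} [MeasurableSpace X] [MeasurableSpace Y]
    {μ : Measure X} {ν : Measure Y} [IsFiniteMeasure μ] [IsFiniteMeasure ν]
    {e : X → ℝ} (he : Integrable e μ) {F : X → Y → ℝ} {M : ℝ}
    (hF : AEStronglyMeasurable (fun p : X × Y => F p.1 p.2) (μ.prod ν))
    (hM : ∀ᵐ p ∂μ.prod ν, ‖F p.1 p.2‖ ≤ M) :
    ∫ x, e x * ∫ y, F x y ∂ν ∂μ = ∫ y, ∫ x, e x * F x y ∂μ ∂ν := by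
  simp_rw [← integral_const_mul]
  exact integral_integral_swap (f := fun x y => e x * F x y) ((he.comp_fst ν).mul_bdd hF hM)

variable {X : Type*} [MeasurableSpace X] {μ : Measure X}

theorem continuous_integral_mul [TopologicalSpace X] [BorelSpace X] [SecondCountableTopology X]
    {Z : Type*} [TopologicalSpace Z] [FirstCountableTopology Z]
    {e : X → ℝ} (he : Integrable e μ) {F : Z → X → ℝ} {M : ℝ}
    (hF : Continuous fun p : Z × X => F p.1 p.2) (hM : ∀ z x, |F z x| ≤ M) :
    Continuous fun z => ∫ x, e x * F z x ∂μ := by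
  refine continuous_of_dominated (bound := fun x => |e x| * M) (fun z => ?_) (fun z => ?_)
    (he.abs.mul_const M) ?_
  · exact he.aestronglyMeasurable.mul
      (hF.comp (Continuous.prodMk_right z)).aestronglyMeasurable
  · refine Eventually.of_forall fun x => ?_
    rw [Real.norm_eq_abs, abs_mul]
    exact mul_le_mul_of_nonneg_left (hM z x) (abs_nonneg _)
  · exact Eventually.of_forall fun x =>
      continuous_const.mul (hF.comp (Continuous.prodMk_left x))

theorem abs_integral_mul_le {e : X → ℝ} (he : Integrable e μ) {F : X → ℝ} {M : ℝ}
    (hM : ∀ x, |F x| ≤ M) : |∫ x, e x * F x ∂μ| ≤ (∫ x, |e x| ∂μ) * M := by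
  rw [← integral_mul_const]
  refine norm_integral_le_of_norm_le (f := fun x => e x * F x) (he.abs.mul_const M)
    (Eventually.of_forall fun x => ?_)
  rw [Real.norm_eq_abs, abs_mul]
  exact mul_le_mul_of_nonneg_left (hM x) (abs_nonneg _)

variable [IsFiniteMeasure μ]

theorem continuous_integral_of_bounded [TopologicalSpace X] [BorelSpace X]
    [SecondCountableTopology X] {Z : Type*} [TopologicalSpace Z] [FirstCountableTopology Z]
    {F : Z → X → ℝ} {M : ℝ} (hF : Continuous fun p : Z × X => F p.1 p.2)
    (hM : ∀ z x, |F z x| ≤ M) : Continuous fun z => ∫ x, F z x ∂μ := by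
  simpa using continuous_integral_mul (μ := μ) (integrable_const (1 : ℝ)) hF hM

theorem abs_integral_le_of_bounded {F : X → ℝ} {M : ℝ} (hM : ∀ x, |F x| ≤ M) :
    |∫ x, F x ∂μ| ≤ μ.real univ * M := by
  simpa using abs_integral_mul_le (μ := μ) (integrable_const (1 : ℝ)) hM

theorem integral_mul_intervalIntegral [TopologicalSpace X] [BorelSpace X]
    [SecondCountableTopology X] {e : X → ℝ} (he : Integrable e μ) {F : X → ℝ → ℝ} {k : ℝ → ℝ}
    {M : ℝ} (hk : Continuous k) (hF : Continuous fun p : X × ℝ => F p.1 p.2)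
    (hM : ∀ x s, |F x s| ≤ M) {t : ℝ} (ht : 0 ≤ t) :
    ∫ x, e x * (∫ s in (0 : ℝ)..t, k s * F x s) ∂μ =
      ∫ s in (0 : ℝ)..t, k s * ∫ x, e x * F x s ∂μ := by
  obtain ⟨L, hL⟩ := isCompact_Icc.exists_bound_of_continuousOn (s := Icc 0 t) hk.continuousOn
  simp_rw [intervalIntegral.integral_of_le ht]
  rw [integral_integral_swap_of_bounded (M := L * M) he]
  · refine integral_congr_ae (Eventually.of_forall fun s => ?_)
    simp only [← integral_const_mul]
    congr! 2 with x
    ring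
  · have : Continuous fun p : X × ℝ => k p.2 * F p.1 p.2 := by fun_prop
    exact this.aestronglyMeasurable
  · have h1 : ∀ᵐ p ∂μ.prod (volume.restrict (Ioc 0 t)), p.2 ∈ Ioc 0 t :=
      (Measure.quasiMeasurePreserving_snd).ae (ae_restrict_mem measurableSet_Ioc)
    filter_upwards [h1] with p hp
    rw [norm_mul]
    have h2 := hL p.2 ⟨hp.1.le, hp.2⟩
    exact mul_le_mul h2 (hM _ _) (norm_nonneg _) ((norm_nonneg _).trans h2)

/-- A linear Volterra inequality forces a continuous function to vanish. -/
theorem eq_zero_of_abs_le_integral {a : ℝ → ℝ} (ha : Continuous a) {T K : ℝ}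
    (h : ∀ t ∈ Ioo 0 T, |a t| ≤ K * ∫ s in (0 : ℝ)..t, |a s|) : ∀ t ∈ Ioo 0 T, a t = 0 := by
  intro t ht
  set F : ℝ → ℝ := fun t => ∫ s in (0 : ℝ)..t, |a s|
  have hF (t : ℝ) : HasDerivAt F |a t| t :=
    intervalIntegral.integral_hasDerivAt_right (ha.abs.intervalIntegrable _ _)
      ha.abs.aestronglyMeasurable.stronglyMeasurableAtFilter ha.abs.continuousAt
  have hF0 : F 0 = 0 := intervalIntegral.integral_same
  have hFc : Continuous F := continuous_iff_continuousAt.2 fun t => (hF t).continuousAt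
  -- Grönwall is applied to F, with F' = |a| ≤ K F and F 0 = 0. It needs the bound at s = 0 too,
  -- which follows by continuity.
  have hle : ∀ s ∈ Ico 0 t, |a s| ≤ K * F s := by
    intro s hs
    rcases hs.1.eq_or_lt with rfl | hs0
    · have hT : (0 : ℝ) < T := ht.1.trans ht.2
      have : ∀ᶠ r in 𝓝[>] (0 : ℝ), |a r| ≤ K * F r := by
        filter_upwards [Ioo_mem_nhdsGT hT] with r hr using h r hr
      exact le_of_tendsto_of_tendsto (ha.abs.continuousWithinAt.tendsto)
        ((continuous_const.mul hFc).continuousWithinAt.tendsto) this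
    · exact h s ⟨hs0, hs.2.trans ht.2⟩
  have hnn : ∀ s, 0 ≤ s → 0 ≤ F s := fun s hs =>
    intervalIntegral.integral_nonneg hs fun _ _ => abs_nonneg _
  have := norm_le_gronwallBound_of_norm_deriv_right_le (f := F) (f' := fun t => |a t|)
    (δ := 0) (K := K) (ε := 0) (a := 0) (b := t) hFc.continuousOn
    (fun s _ => (hF s).hasDerivWithinAt) (by simp [hF0]) (fun s hs => by
      simpa [abs_of_nonneg (hnn s hs.1)] using hle s hs) t ⟨ht.1.le, le_rfl⟩
  simp only [gronwallBound_ε0_δ0] at this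
  have h0 : F t = 0 := by simpa using this
  have := h t ht
  change |a t| ≤ K * F t at this
  rw [h0, mul_zero] at this
  exact abs_nonpos_iff.1 this

variable [MetricSpace X] [CompactSpace X] [BorelSpace X]

theorem integral_eigenfunction_mul {P : X → X → ℝ} (hP : Continuous fun p : X × X => P p.1 p.2)
    (hPs : ∀ x y, P x y = P y x) {e : X → ℝ} (he : Integrable e μ) {c : ℝ}
    (hc : ∀ᵐ x ∂μ, ∫ ξ, P x ξ * e ξ ∂μ = c * e x) {f : X → ℝ} (hf : Continuous f) :
    ∫ x, e x * ∫ ξ, P x ξ * f ξ ∂μ ∂μ = c * ∫ x, e x * f x ∂μ := by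
  have hfi : Integrable f μ := hf.integrable_of_hasCompactSupport (HasCompactSupport.of_compactSpace f)
  rw [← integral_kernel_comm hP hPs he hfi, ← integral_const_mul]
  refine integral_congr_ae ?_
  filter_upwards [hc] with x hx
  rw [hx]; ring

variable {Y : Type*} [MetricSpace Y] [CompactSpace Y] [MeasurableSpace Y] [BorelSpace Y]
  {ν : Measure Y} [IsFiniteMeasure ν]

/-- The identity is integrated against g in y. Symmetry of Q moves it onto g and produces the factor
c, while Fubini pulls the y-integral inside P; the variable x stays free for a second projection. -/
theorem eigen_coefficient_identity {P : X → X → ℝ} {Q : Y → Y → ℝ}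
    (hP : Continuous fun p : X × X => P p.1 p.2)
    (hQ : Continuous fun p : Y × Y => Q p.1 p.2) (hQs : ∀ x y, Q x y = Q y x)
    {k : ℝ → ℝ} (hk : Continuous k) {C M : ℝ} {ω : X → Y → ℝ → ℝ}
    (hω : Continuous fun p : X × Y × ℝ => ω p.1 p.2.1 p.2.2) (hM : ∀ x y t, |ω x y t| ≤ M)
    {t : ℝ} (ht : 0 ≤ t) {x : X}
    (hid : ∀ y, ∫ ξ, P x ξ * ∫ η, Q y η * ω ξ η t ∂ν ∂μ =
      C * ∫ s in (0 : ℝ)..t, k s * ((∫ η, Q y η * ω x η s ∂ν) + ∫ ξ, P x ξ * ω ξ y s ∂μ))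
    {g : Y → ℝ} (hg : Integrable g ν) {c : ℝ}
    (hc : ∀ᵐ y ∂ν, ∫ η, Q y η * g η ∂ν = c * g y) :
    c * ∫ ξ, P x ξ * ∫ y, g y * ω ξ y t ∂ν ∂μ =
      C * ∫ s in (0 : ℝ)..t, k s *
        (c * (∫ y, g y * ω x y s ∂ν) + ∫ ξ, P x ξ * (∫ y, g y * ω ξ y s ∂ν) ∂μ) := by
  obtain ⟨L, hL⟩ := isCompact_univ.exists_bound_of_continuousOn hP.continuousOn
  obtain ⟨N, hN⟩ := isCompact_univ.exists_bound_of_continuousOn hQ.continuousOn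
  have hP' : ∀ x ξ, |P x ξ| ≤ L := fun x ξ => hL (x, ξ) (mem_univ _)
  have hQ' : ∀ y η, |Q y η| ≤ N := fun y η => hN (y, η) (mem_univ _)
  have hPω : ∀ ξ y s, |P x ξ * ω ξ y s| ≤ L * M := fun ξ y s => by
    rw [abs_mul]; exact mul_le_mul (hP' _ _) (hM _ _ _) (abs_nonneg _) ((abs_nonneg _).trans (hP' x x))
  have hQω : ∀ ξ y η s, |Q y η * ω ξ η s| ≤ N * M := fun ξ y η s => by
    rw [abs_mul]; exact mul_le_mul (hQ' _ _) (hM _ _ _) (abs_nonneg _) ((abs_nonneg _).trans (hQ' y y))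
  have cU : Continuous fun p : X × Y × ℝ => ∫ η, Q p.2.1 η * ω p.1 η p.2.2 ∂ν :=
    continuous_integral_of_bounded (M := N * M) (by fun_prop) fun z η => hQω _ _ _ _
  have cV : Continuous fun p : Y × ℝ => ∫ ξ, P x ξ * ω ξ p.1 p.2 ∂μ :=
    continuous_integral_of_bounded (M := L * M) (by fun_prop) fun z ξ => hPω _ _ _
  have bU : ∀ ξ y s, |∫ η, Q y η * ω ξ η s ∂ν| ≤ ν.real univ * (N * M) := fun ξ y s =>
    abs_integral_le_of_bounded fun η => hQω _ _ _ _
  have bV : ∀ y s, |∫ ξ, P x ξ * ω ξ y s ∂μ| ≤ μ.real univ * (L * M) := fun y s =>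
    abs_integral_le_of_bounded fun η => hPω _ _ _
  have key : ∫ y, g y * (∫ ξ, P x ξ * ∫ η, Q y η * ω ξ η t ∂ν ∂μ) ∂ν =
      ∫ y, g y * (C * ∫ s in (0 : ℝ)..t, k s *
        ((∫ η, Q y η * ω x η s ∂ν) + ∫ ξ, P x ξ * ω ξ y s ∂μ)) ∂ν := by
    simp_rw [hid]
  have swapP : ∀ (U : X → Y → ℝ) (_ : Continuous fun p : X × Y => U p.1 p.2),
      ∫ y, g y * ∫ ξ, P x ξ * U ξ y ∂μ ∂ν = ∫ ξ, P x ξ * ∫ y, g y * U ξ y ∂ν ∂μ := by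
    intro U hU
    have hc : Continuous fun p : Y × X => P x p.2 * U p.2 p.1 := by fun_prop
    obtain ⟨B, hB⟩ := isCompact_univ.exists_bound_of_continuousOn hc.continuousOn
    rw [integral_integral_swap_of_bounded (M := B) hg hc.aestronglyMeasurable
      (Eventually.of_forall fun p => hB p (mem_univ _))]
    simp_rw [← integral_const_mul]
    congr! 4 with ξ y
    ring
  have cU' (s : ℝ) : Continuous fun p : X × Y => ∫ η, Q p.2 η * ω p.1 η s ∂ν :=
    cU.comp (g := fun p : X × Y × ℝ => ∫ η, Q p.2.1 η * ω p.1 η p.2.2 ∂ν)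
      (f := fun p : X × Y => (p.1, p.2, s)) (by fun_prop)
  have cUx : Continuous fun p : Y × ℝ => ∫ η, Q p.1 η * ω x η p.2 ∂ν :=
    cU.comp (g := fun p : X × Y × ℝ => ∫ η, Q p.2.1 η * ω p.1 η p.2.2 ∂ν)
      (f := fun p : Y × ℝ => (x, p.1, p.2)) (by fun_prop)
  rw [swapP _ (cU' t)] at key
  have e1 : ∀ ξ s, ∫ y, g y * ∫ η, Q y η * ω ξ η s ∂ν ∂ν = c * ∫ y, g y * ω ξ y s ∂ν :=
    fun ξ s => integral_eigenfunction_mul hQ hQs hg hc (by fun_prop)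
  simp_rw [e1] at key
  have e2 : c * ∫ ξ, P x ξ * ∫ y, g y * ω ξ y t ∂ν ∂μ =
      ∫ ξ, P x ξ * (c * ∫ y, g y * ω ξ y t ∂ν) ∂μ := by
    rw [← integral_const_mul]
    congr! 2 with ξ
    ring
  rw [e2, key]
  simp_rw [mul_left_comm (g _) C, integral_const_mul]
  rw [integral_mul_intervalIntegral (M := ν.real univ * (N * M) + μ.real univ * (L * M)) hg hk
    (cUx.add cV) (fun y s => (abs_add_le _ _).trans (add_le_add (bU _ _ _) (bV _ _))) ht]
  congr! 4 with s
  rw [← e1, ← swapP _ (by fun_prop), ← integral_add]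
  · simp_rw [mul_add]
  · exact hg.mul_bdd (c := ν.real univ * (N * M))
      (cUx.comp (Continuous.prodMk_left s)).aestronglyMeasurable
      (Eventually.of_forall fun y => bU _ _ _)
  · exact hg.mul_bdd (c := μ.real univ * (L * M))
      (cV.comp (Continuous.prodMk_left s)).aestronglyMeasurable
      (Eventually.of_forall fun y => bV _ _)

/-- Each double coefficient a of ω satisfies the scalar Volterra equation c d a(t) = C (c + d) ∫₀ᵗ
(t - s) ^ β a(s) ds, and so vanishes by Grönwall. Completeness of the eigenfunctions, used first in
x and then in y, gives ω = 0. -/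
theorem eq_zero_of_kernel_identity [μ.IsOpenPosMeasure] [ν.IsOpenPosMeasure]
    {P : X → X → ℝ} {Q : Y → Y → ℝ}
    (hP : Continuous fun p : X × X => P p.1 p.2) (hPs : ∀ x y, P x y = P y x)
    (hPinj : ∀ e : X → ℝ, MemLp e 2 μ → (∀ᵐ x ∂μ, ∫ ξ, P x ξ * e ξ ∂μ = 0) → e =ᵐ[μ] 0)
    (hQ : Continuous fun p : Y × Y => Q p.1 p.2) (hQs : ∀ x y, Q x y = Q y x)
    (hQinj : ∀ g : Y → ℝ, MemLp g 2 ν → (∀ᵐ y ∂ν, ∫ η, Q y η * g η ∂ν = 0) → g =ᵐ[ν] 0)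
    {β C M T : ℝ} (hβ : 0 ≤ β) {ω : X → Y → ℝ → ℝ}
    (hω : Continuous fun p : X × Y × ℝ => ω p.1 p.2.1 p.2.2) (hM : ∀ x y t, |ω x y t| ≤ M)
    (hid : ∀ x y, ∀ t ∈ Ioo 0 T, ∫ ξ, P x ξ * ∫ η, Q y η * ω ξ η t ∂ν ∂μ =
      C * ∫ s in (0 : ℝ)..t, (t - s) ^ β *
        ((∫ η, Q y η * ω x η s ∂ν) + ∫ ξ, P x ξ * ω ξ y s ∂μ)) :
    ∀ t ∈ Ioo 0 T, ∀ x y, ω x y t = 0 := by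
  have hk (t : ℝ) : Continuous fun s : ℝ => (t - s) ^ β :=
    (continuous_const.sub continuous_id).rpow_const fun _ => Or.inr hβ
  obtain ⟨L, hL⟩ := isCompact_univ.exists_bound_of_continuousOn hP.continuousOn
  have hP' : ∀ x ξ, |P x ξ| ≤ L := fun x ξ => hL (x, ξ) (mem_univ _)
  have coeff : ∀ (e : X → ℝ) (c : ℝ), MemLp e 2 μ → (∀ᵐ x ∂μ, ∫ ξ, P x ξ * e ξ ∂μ = c * e x) →
      ∀ (g : Y → ℝ) (d : ℝ), MemLp g 2 ν → (∀ᵐ y ∂ν, ∫ η, Q y η * g η ∂ν = d * g y) →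
      ∀ t ∈ Ioo 0 T, ∫ x, e x * ∫ y, g y * ω x y t ∂ν ∂μ = 0 := by
    intro e c he hc g d hg hd
    have hei := he.integrable one_le_two
    have hgi := hg.integrable one_le_two
    -- Injectivity forces an eigenfunction with eigenvalue 0 to vanish almost everywhere, so only
    -- nonzero c and d remain.
    by_cases hc0 : c = 0
    · have := hPinj e he (by simpa [hc0] using hc)
      intro t _
      refine integral_eq_zero_of_ae ?_
      filter_upwards [this] with x hx
      simp [hx]
    by_cases hd0 : d = 0
    · have := hQinj g hg (by simpa [hd0] using hd)
      intro t _
      have h0 : ∀ x, ∫ y, g y * ω x y t ∂ν = 0 := fun x => by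
        refine integral_eq_zero_of_ae ?_
        filter_upwards [this] with y hy
        simp [hy]
      simp [h0]
    set A : X → ℝ → ℝ := fun x t => ∫ y, g y * ω x y t ∂ν
    have cA : Continuous fun p : X × ℝ => A p.1 p.2 :=
      continuous_integral_mul (M := M) hgi (F := fun (p : X × ℝ) y => ω p.1 y p.2)
        (by fun_prop) fun _ _ => hM _ _ _
    have bA : ∀ x s, |A x s| ≤ (∫ y, |g y| ∂ν) * M := fun x s => abs_integral_mul_le hgi fun _ => hM _ _ _
    have hPA : ∀ x ξ s, |P x ξ * A ξ s| ≤ L * ((∫ y, |g y| ∂ν) * M) := fun x ξ s => by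
      rw [abs_mul]; exact mul_le_mul (hP' _ _) (bA _ _) (abs_nonneg _) ((abs_nonneg _).trans (hP' x x))
    have cB : Continuous fun p : X × ℝ => ∫ ξ, P p.1 ξ * A ξ p.2 ∂μ :=
      continuous_integral_of_bounded (F := fun (p : X × ℝ) ξ => P p.1 ξ * A ξ p.2)
        (by fun_prop) fun z ξ => hPA _ _ _
    have bB : ∀ x s, |∫ ξ, P x ξ * A ξ s ∂μ| ≤ μ.real univ * (L * ((∫ y, |g y| ∂ν) * M)) :=
      fun x s => abs_integral_le_of_bounded fun ξ => hPA _ _ _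
    set a : ℝ → ℝ := fun t => ∫ x, e x * A x t ∂μ
    have ca : Continuous a :=
      continuous_integral_mul (F := fun t x => A x t) hei (by fun_prop) fun _ _ => bA _ _
    have hPe : ∀ s, ∫ x, e x * ∫ ξ, P x ξ * A ξ s ∂μ ∂μ = c * a s := fun s =>
      integral_eigenfunction_mul hP hPs hei hc (by fun_prop)
    have ida : ∀ t ∈ Ioo 0 T, c * d * a t =
        C * ∫ s in (0 : ℝ)..t, (t - s) ^ β * ((c + d) * a s) := by
      intro t ht
      have h1 : ∀ x, _ := fun x => eigen_coefficient_identity hP hQ hQs (hk t) hω hM ht.1.le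
        (fun y => hid x y t ht) hgi hd
      have h2 : ∫ x, e x * (d * ∫ ξ, P x ξ * A ξ t ∂μ) ∂μ = ∫ x, e x * (C * ∫ s in (0 : ℝ)..t,
          (t - s) ^ β * (d * A x s + ∫ ξ, P x ξ * A ξ s ∂μ)) ∂μ := by
        simp_rw [A, h1]
      simp_rw [mul_left_comm (e _), integral_const_mul, hPe] at h2
      rw [integral_mul_intervalIntegral (k := fun s => (t - s) ^ β)
        (M := |d| * ((∫ y, |g y| ∂ν) * M) + μ.real univ * (L * ((∫ y, |g y| ∂ν) * M))) hei (hk t)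
        (F := fun x s => d * A x s + ∫ ξ, P x ξ * A ξ s ∂μ)
        (by fun_prop) (fun x s => (abs_add_le _ _).trans
          (add_le_add (by rw [abs_mul]; exact mul_le_mul_of_nonneg_left (bA _ _) (abs_nonneg _))
            (bB _ _))) ht.1.le] at h2
      rw [mul_comm c d, mul_assoc, h2]
      congr! 4 with s
      have i1 : Integrable (fun x => e x * (d * A x s)) μ :=
        hei.mul_bdd (c := |d| * ((∫ y, |g y| ∂ν) * M))
          (Continuous.aestronglyMeasurable (by fun_prop))
          (Eventually.of_forall fun x => by
            rw [norm_mul]; exact mul_le_mul_of_nonneg_left (bA _ _) (abs_nonneg _))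
      have i2 : Integrable (fun x => e x * ∫ ξ, P x ξ * A ξ s ∂μ) μ :=
        hei.mul_bdd (cB.comp (Continuous.prodMk_left s)).aestronglyMeasurable
          (Eventually.of_forall fun x => bB _ _)
      simp_rw [mul_add]
      rw [integral_add i1 i2, hPe]
      simp_rw [mul_left_comm (e _) d, integral_const_mul]
      change d * a s + c * a s = _
      ring
    -- The constant comes from dividing `ida` by c d and bounding (t - s) ^ β by T ^ β, which is
    -- legitimate since β ≥ 0.
    refine eq_zero_of_abs_le_integral ca (K := |c * d|⁻¹ * (|C| * (T ^ β * |c + d|))) ?_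
    intro t ht
    have hcd : 0 < |c * d| := abs_pos.2 (mul_ne_zero hc0 hd0)
    rw [mul_assoc, ← div_eq_inv_mul, le_div_iff₀ hcd, mul_comm, ← abs_mul, ida t ht, abs_mul,
      mul_assoc]
    refine mul_le_mul_of_nonneg_left ?_ (abs_nonneg _)
    rw [← intervalIntegral.integral_const_mul]
    have hgi : IntervalIntegrable (fun s => T ^ β * |c + d| * |a s|) volume 0 t :=
      (continuous_const.mul ca.abs).intervalIntegrable _ _
    refine intervalIntegral.norm_integral_le_of_norm_le (μ := volume)
      (f := fun s => (t - s) ^ β * ((c + d) * a s)) (g := fun s => T ^ β * |c + d| * |a s|)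
      ht.1.le (Eventually.of_forall ?_) hgi
    intro s hs
    rw [Real.norm_eq_abs, abs_mul, abs_mul, ← mul_assoc]
    refine mul_le_mul_of_nonneg_right (mul_le_mul_of_nonneg_right ?_ (abs_nonneg _)) (abs_nonneg _)
    rw [abs_of_nonneg (Real.rpow_nonneg (by linarith [hs.2]) _)]
    exact Real.rpow_le_rpow (by linarith [hs.2]) (by linarith [hs.1, ht.2]) hβ
  intro t ht x y
  have step : ∀ (g : Y → ℝ) (d : ℝ), MemLp g 2 ν →
      (∀ᵐ y ∂ν, ∫ η, Q y η * g η ∂ν = d * g y) → ∀ x, ∫ y, g y * ω x y t ∂ν = 0 := by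
    intro g d hg hd
    have cA : Continuous fun x => ∫ y, g y * ω x y t ∂ν :=
      continuous_integral_mul (M := M) (hg.integrable one_le_two) (F := fun x y => ω x y t)
        (by fun_prop) fun _ _ => hM _ _ _
    have := ae_eq_zero_of_forall_eigenfunction (μ := μ) hP hPs cA
      fun e c he hc => coeff e c he hc g d hg hd t ht
    -- Continuity in x, with a measure positive on open sets, upgrades vanishing almost everywhere
    -- to every x, which the projection in y requires.
    exact congrFun ((Continuous.ae_eq_iff_eq μ cA continuous_const).1 this)
  have cω : Continuous fun y => ω x y t := by fun_prop
  have := ae_eq_zero_of_forall_eigenfunction (μ := ν) hQ hQs cω fun g d hg hd => step g d hg hd x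
  exact congrFun ((Continuous.ae_eq_iff_eq ν cω continuous_const).1 this) y

end Projection

/-! ### Green representation on an interval -/

section Green

/-- The Green function on `[a, c]`, with pole `b`, of the second order operator with scale
function `S`. -/
noncomputable def green (S : ℝ → ℝ) (a c b ξ : ℝ) : ℝ :=
  (S (min b ξ) - S a) * (S c - S (max b ξ)) / (S c - S a)

/-- Since w' = S' m, the primitives of (S - S a) m' and (S c - S) m' are (S - S a) m - w and (S c -
S) m + w. Weighted and added at the pole b, their m b terms cancel, leaving only values of w. -/
theorem integral_green_mul {S S' m m' w : ℝ → ℝ} {a b c : ℝ} (hab : a ≤ b) (hbc : b ≤ c)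
    (hne : S c - S a ≠ 0)
    (hS : ∀ ξ ∈ Icc a c, HasDerivAt S (S' ξ) ξ) (hm : ∀ ξ ∈ Icc a c, HasDerivAt m (m' ξ) ξ)
    (hm' : ContinuousOn m' (Icc a c)) (hw : ∀ ξ ∈ Icc a c, HasDerivAt w (S' ξ * m ξ) ξ) :
    ∫ ξ in a..c, green S a c b ξ * m' ξ =
      -w b + (S c - S b) / (S c - S a) * w a + (S b - S a) / (S c - S a) * w c := by
  have hSc : ContinuousOn S (Icc a c) := fun ξ hξ => (hS ξ hξ).continuousAt.continuousWithinAt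
  have e1 : EqOn (fun ξ => green S a c b ξ * m' ξ)
      (fun ξ => (S c - S b) / (S c - S a) * ((S ξ - S a) * m' ξ)) (uIcc a b) := by
    intro ξ hξ
    rw [uIcc_of_le hab] at hξ
    simp only [green, min_eq_right hξ.2, max_eq_left hξ.2]
    field_simp
  have e2 : EqOn (fun ξ => green S a c b ξ * m' ξ)
      (fun ξ => (S b - S a) / (S c - S a) * ((S c - S ξ) * m' ξ)) (uIcc b c) := by
    intro ξ hξ
    rw [uIcc_of_le hbc] at hξ
    simp only [green, min_eq_left hξ.1, max_eq_right hξ.1]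
    field_simp
  have s1 : uIcc a b ⊆ Icc a c := by rw [uIcc_of_le hab]; exact Icc_subset_Icc_right hbc
  have s2 : uIcc b c ⊆ Icc a c := by rw [uIcc_of_le hbc]; exact Icc_subset_Icc_left hab
  have i1 : IntervalIntegrable (fun ξ => (S ξ - S a) * m' ξ) volume a b :=
    (((hSc.mono s1).sub continuousOn_const).mul (hm'.mono s1)).intervalIntegrable
  have i2 : IntervalIntegrable (fun ξ => (S c - S ξ) * m' ξ) volume b c :=
    ((continuousOn_const.sub (hSc.mono s2)).mul (hm'.mono s2)).intervalIntegrable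
  have v1 : ∫ ξ in a..b, (S ξ - S a) * m' ξ = (S b - S a) * m b - w b - (-w a) := by
    rw [intervalIntegral.integral_eq_sub_of_hasDerivAt
      (f := fun ξ => (S ξ - S a) * m ξ - w ξ) (fun ξ hξ => ?_) i1]
    · simp
    · exact ((((hS ξ (s1 hξ)).sub_const (S a)).mul (hm ξ (s1 hξ))).sub
        (hw ξ (s1 hξ))).congr_deriv (by ring)
  have v2 : ∫ ξ in b..c, (S c - S ξ) * m' ξ = w c - ((S c - S b) * m b + w b) := by
    rw [intervalIntegral.integral_eq_sub_of_hasDerivAt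
      (f := fun ξ => (S c - S ξ) * m ξ + w ξ) (fun ξ hξ => ?_) i2]
    · simp
    · exact ((((hS ξ (s2 hξ)).const_sub (S c)).mul (hm ξ (s2 hξ))).add
        (hw ξ (s2 hξ))).congr_deriv (by ring)
  rw [← intervalIntegral.integral_add_adjacent_intervals (b := b)
    ((i1.const_mul _).congr (e1.symm.mono uIoc_subset_uIcc))
    ((i2.const_mul _).congr (e2.symm.mono uIoc_subset_uIcc)),
    intervalIntegral.integral_congr e1, intervalIntegral.integral_congr e2,
    intervalIntegral.integral_const_mul, intervalIntegral.integral_const_mul, v1, v2]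
  field_simp
  ring

end Green

/-! ### Reduction to the homogeneous problem -/

section Difference

variable {α T : ℝ} {f : ℝ → ℝ → ℝ → ℝ} {φ ψ : ℝ → ℝ → ℝ} {u v : ℝ → ℝ → ℝ → ℝ}

theorem deriv_deriv_sub_of_caputoExists {g h : ℝ → ℝ} {t : ℝ} (hg : CaputoExists α g t)
    (hh : CaputoExists α h t) : ∀ s ∈ Ioo 0 t,
    deriv (deriv fun τ => g τ - h τ) s = deriv (deriv g) s - deriv (deriv h) s := by
  intro s hs
  rw [← deriv_fun_sub (hg.1 s hs).2 (hh.1 s hs).2]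
  refine EventuallyEq.deriv_eq ?_
  filter_upwards [Ioo_mem_nhds hs.1 hs.2] with z hz
  exact deriv_fun_sub (hg.1 z hz).1 (hh.1 z hz).1

theorem caputoIntegrand_sub {g h : ℝ → ℝ} {t : ℝ} (hg : CaputoExists α g t)
    (hh : CaputoExists α h t) : EqOn (caputoIntegrand α (fun τ => g τ - h τ) t)
      (fun s => caputoIntegrand α g t s - caputoIntegrand α h t s) (Ioo 0 t) := by
  intro s hs
  simp only [caputoIntegrand, deriv_deriv_sub_of_caputoExists hg hh s hs, sub_div]

theorem CaputoExists.sub {g h : ℝ → ℝ} {t : ℝ} (ht : 0 ≤ t) (hg : CaputoExists α g t)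
    (hh : CaputoExists α h t) : CaputoExists α (fun τ => g τ - h τ) t := by
  refine ⟨fun s hs => ⟨(hg.1 s hs).1.sub (hh.1 s hs).1, ?_⟩, ?_⟩
  · have := (hg.1 s hs).2.sub (hh.1 s hs).2
    refine this.congr_of_eventuallyEq ?_
    filter_upwards [Ioo_mem_nhds hs.1 hs.2] with z hz
    exact deriv_fun_sub (hg.1 z hz).1 (hh.1 z hz).1
  · have := hg.2.sub hh.2
    rw [intervalIntegrable_iff_integrableOn_Ioo_of_le ht] at this ⊢
    exact this.congr_fun (caputoIntegrand_sub hg hh).symm measurableSet_Ioo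

theorem caputo_sub {g h : ℝ → ℝ} {t : ℝ} (ht : 0 ≤ t) (hg : CaputoExists α g t)
    (hh : CaputoExists α h t) :
    caputo α (fun τ => g τ - h τ) t = caputo α g t - caputo α h t := by
  simp only [caputo]
  rw [← mul_sub, ← intervalIntegral.integral_sub hg.2 hh.2, intervalIntegral.integral_of_le ht,
    intervalIntegral.integral_of_le ht, integral_Ioc_eq_integral_Ioo, integral_Ioc_eq_integral_Ioo,
    setIntegral_congr_fun measurableSet_Ioo (caputoIntegrand_sub hg hh)]

/-- The difference of two solutions solves the homogeneous problem. -/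
theorem IsContinuousSolution.sub (hT : 0 < T) (hu : IsContinuousSolution α T f φ ψ u)
    (hv : IsContinuousSolution α T f φ ψ v) :
    IsContinuousSolution α T (fun _ _ _ => 0) (fun _ _ => 0) (fun _ _ => 0)
      (fun x y t => u x y t - v x y t) := by
  set w : ℝ → ℝ → ℝ → ℝ := fun x y t => u x y t - v x y t
  have hdt : ∀ x ∈ Ioo (0 : ℝ) 1, ∀ y ∈ Ioo (0 : ℝ) 1, ∀ t ∈ Ico 0 T,
      dt w x y t = dt u x y t - dt v x y t := fun x hx y hy t ht =>
    derivWithin_fun_sub (hu.differentiable_t x hx y hy t ht) (hv.differentiable_t x hx y hy t ht)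
  have hdx : ∀ x ∈ Ioo (0 : ℝ) 1, ∀ y ∈ Ioo (0 : ℝ) 1, ∀ t ∈ Ioo 0 T,
      dx w x y t = dx u x y t - dx v x y t := fun x hx y hy t ht =>
    deriv_fun_sub (hu.differentiable_x x hx y hy t ht).1 (hv.differentiable_x x hx y hy t ht).1
  have hdy : ∀ x ∈ Ioo (0 : ℝ) 1, ∀ y ∈ Ioo (0 : ℝ) 1, ∀ t ∈ Ioo 0 T,
      dy w x y t = dy u x y t - dy v x y t := fun x hx y hy t ht =>
    deriv_fun_sub (hu.differentiable_y x hx y hy t ht).1 (hv.differentiable_y x hx y hy t ht).1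
  have hdx' : ∀ x ∈ Ioo (0 : ℝ) 1, ∀ y ∈ Ioo (0 : ℝ) 1, ∀ t ∈ Ioo 0 T,
      (fun ξ => dx w ξ y t) =ᶠ[𝓝 x] fun ξ => dx u ξ y t - dx v ξ y t := fun x hx y hy t ht => by
    filter_upwards [Ioo_mem_nhds hx.1 hx.2] with ξ hξ using hdx ξ hξ y hy t ht
  have hdy' : ∀ x ∈ Ioo (0 : ℝ) 1, ∀ y ∈ Ioo (0 : ℝ) 1, ∀ t ∈ Ioo 0 T,
      (fun η => dy w x η t) =ᶠ[𝓝 y] fun η => dy u x η t - dy v x η t := fun x hx y hy t ht => by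
    filter_upwards [Ioo_mem_nhds hy.1 hy.2] with η hη using hdy x hx η hη t ht
  have hdxx : ∀ x ∈ Ioo (0 : ℝ) 1, ∀ y ∈ Ioo (0 : ℝ) 1, ∀ t ∈ Ioo 0 T,
      dxx w x y t = dxx u x y t - dxx v x y t := fun x hx y hy t ht =>
    (hdx' x hx y hy t ht).deriv_eq.trans
      (deriv_fun_sub (hu.differentiable_x x hx y hy t ht).2 (hv.differentiable_x x hx y hy t ht).2)
  have hdyy : ∀ x ∈ Ioo (0 : ℝ) 1, ∀ y ∈ Ioo (0 : ℝ) 1, ∀ t ∈ Ioo 0 T,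
      dyy w x y t = dyy u x y t - dyy v x y t := fun x hx y hy t ht =>
    (hdy' x hx y hy t ht).deriv_eq.trans
      (deriv_fun_sub (hu.differentiable_y x hx y hy t ht).2 (hv.differentiable_y x hx y hy t ht).2)
  constructor
  · exact hu.continuousOn.sub hv.continuousOn
  · exact fun x hx y hy t ht =>
      (hu.differentiable_t x hx y hy t ht).sub (hv.differentiable_t x hx y hy t ht)
  · exact (hu.continuousOn_dt.sub hv.continuousOn_dt).congr
      fun p hp => hdt _ hp.1 _ hp.2.1 _ hp.2.2
  · exact fun x hx y hy t ht => ⟨(hu.differentiable_x x hx y hy t ht).1.sub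
      (hv.differentiable_x x hx y hy t ht).1, ((hu.differentiable_x x hx y hy t ht).2.sub
      (hv.differentiable_x x hx y hy t ht).2).congr_of_eventuallyEq (hdx' x hx y hy t ht)⟩
  · exact fun x hx y hy t ht => ⟨(hu.differentiable_y x hx y hy t ht).1.sub
      (hv.differentiable_y x hx y hy t ht).1, ((hu.differentiable_y x hx y hy t ht).2.sub
      (hv.differentiable_y x hx y hy t ht).2).congr_of_eventuallyEq (hdy' x hx y hy t ht)⟩
  · exact (hu.continuousOn_dx.sub hv.continuousOn_dx).congr
      fun p hp => hdx _ hp.1 _ hp.2.1 _ hp.2.2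
  · exact (hu.continuousOn_dxx.sub hv.continuousOn_dxx).congr
      fun p hp => hdxx _ hp.1 _ hp.2.1 _ hp.2.2
  · exact (hu.continuousOn_dyy.sub hv.continuousOn_dyy).congr
      fun p hp => hdyy _ hp.1 _ hp.2.1 _ hp.2.2
  · exact fun x hx y hy t ht =>
      (hu.caputoExists x hx y hy t ht).sub ht.1.le (hv.caputoExists x hx y hy t ht)
  · intro x hx y hy t ht
    rw [caputo_sub ht.1.le (hu.caputoExists x hx y hy t ht) (hv.caputoExists x hx y hy t ht),
      hu.equation x hx y hy t ht, hv.equation x hx y hy t ht, hdx x hx y hy t ht,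
      hdxx x hx y hy t ht, hdyy x hx y hy t ht]
    ring
  · intro y hy t ht
    have := (hu.boundary_x_zero y hy t ht).sub (hv.boundary_x_zero y hy t ht)
    rw [sub_zero] at this
    refine this.congr' ?_
    filter_upwards [Ioo_mem_nhdsGT (zero_lt_one' ℝ)] with x hx
    rw [hdx x hx y hy t ht, mul_sub]
  · exact fun y hy t ht => by
      simp [w, hu.boundary_x_one y hy t ht, hv.boundary_x_one y hy t ht]
  · exact fun x hx t ht => by
      simp [w, hu.boundary_y_zero x hx t ht, hv.boundary_y_zero x hx t ht]
  · exact fun x hx t ht => by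
      simp [w, hu.boundary_y_one x hx t ht, hv.boundary_y_one x hx t ht]
  · exact fun x hx y hy => by
      simp [w, hu.initial_value x hx y hy, hv.initial_value x hx y hy]
  · exact fun x hx y hy => by
      rw [hdt x hx y hy 0 ⟨le_rfl, hT⟩, hu.initial_velocity x hx y hy,
        hv.initial_velocity x hx y hy, sub_self]

end Difference

/-! ### Time integration and boundary terms on a rectangle -/

section Rectangle

/-- Fubini on the product of a compact set and a time interval. -/
theorem integral_time_swap {K : Set (ℝ × ℝ)} (hK : IsCompact K) {ε t : ℝ} (hεt : ε ≤ t)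
    {k : ℝ → ℝ} (hk : IntervalIntegrable k volume ε t) {F : ℝ × ℝ → ℝ → ℝ}
    (hF : ContinuousOn (fun p : (ℝ × ℝ) × ℝ => F p.1 p.2) (K ×ˢ Icc ε t)) :
    IntervalIntegrable (fun s => k s * ∫ z in K, F z s) volume ε t ∧
    IntegrableOn (fun z => ∫ s in ε..t, k s * F z s) K ∧
    ∫ s in ε..t, k s * (∫ z in K, F z s) = ∫ z in K, ∫ s in ε..t, k s * F z s := by
  have hk' : Integrable k (volume.restrict (Icc ε t)) :=
    (intervalIntegrable_iff_integrableOn_Icc_of_le hεt).1 hk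
  have hfin : IsFiniteMeasure ((volume : Measure (ℝ × ℝ)).restrict K) :=
    ⟨by simpa using hK.measure_lt_top⟩
  have hprod : (volume.restrict (Icc ε t)).prod ((volume : Measure (ℝ × ℝ)).restrict K) =
      (volume.prod volume).restrict (Icc ε t ×ˢ K) := Measure.prod_restrict _ _
  have hms : MeasurableSet (Icc ε t ×ˢ K) := measurableSet_Icc.prod hK.measurableSet
  have hF' : ContinuousOn (fun p : ℝ × ℝ × ℝ => F p.2 p.1) (Icc ε t ×ˢ K) :=
    hF.comp (f := fun p : ℝ × ℝ × ℝ => (p.2, p.1)) (by fun_prop) fun p hp => ⟨hp.2, hp.1⟩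
  obtain ⟨M, hM⟩ := (isCompact_Icc.prod hK).exists_bound_of_continuousOn hF'
  have hint : Integrable (fun p : ℝ × ℝ × ℝ => k p.1 * F p.2 p.1)
      ((volume.restrict (Icc ε t)).prod ((volume : Measure (ℝ × ℝ)).restrict K)) := by
    refine (hk'.comp_fst _).mul_bdd (c := M) ?_ ?_
    · rw [hprod]; exact hF'.aestronglyMeasurable hms
    · rw [hprod]; exact (ae_restrict_mem hms).mono hM
  have e1 : ∀ z, ∫ s in ε..t, k s * F z s = ∫ s in Icc ε t, k s * F z s := fun z => by
    rw [intervalIntegral.integral_of_le hεt, integral_Icc_eq_integral_Ioc]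
  refine ⟨?_, ?_, ?_⟩
  · rw [intervalIntegrable_iff_integrableOn_Icc_of_le hεt]
    simp_rw [← integral_const_mul]
    exact hint.integral_prod_left
  · simp_rw [e1]
    exact hint.integral_prod_right
  · simp_rw [e1, ← integral_const_mul]
    rw [intervalIntegral.integral_of_le hεt, ← integral_Icc_eq_integral_Ioc]
    exact integral_integral_swap hint

/-- The boundary terms in the representation by the Green function. -/
noncomputable def greenBoundary (S : ℝ → ℝ) (a c b : ℝ) (g : ℝ → ℝ) : ℝ :=
  -g b + (S c - S b) / (S c - S a) * g a + (S b - S a) / (S c - S a) * g c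

theorem abs_greenBoundary_le {S : ℝ → ℝ} {a c b M : ℝ} {g : ℝ → ℝ} (h1 : S a ≤ S b)
    (h2 : S b ≤ S c) (hg : ∀ x, |g x| ≤ M) : |greenBoundary S a c b g| ≤ 3 * M := by
  have hθ₁ : |(S c - S b) / (S c - S a)| ≤ 1 := by
    rw [abs_div]
    exact div_le_one_of_le₀ (abs_le_abs_of_nonneg (by linarith) (by linarith)) (abs_nonneg _)
  have hθ₂ : |(S b - S a) / (S c - S a)| ≤ 1 := by
    rw [abs_div]
    exact div_le_one_of_le₀ (abs_le_abs_of_nonneg (by linarith) (by linarith)) (abs_nonneg _)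
  have hM : 0 ≤ M := (abs_nonneg _).trans (hg 0)
  have e1 : |(S c - S b) / (S c - S a) * g a| ≤ 1 * M := by
    rw [abs_mul]; exact mul_le_mul hθ₁ (hg a) (abs_nonneg _) zero_le_one
  have e2 : |(S b - S a) / (S c - S a) * g c| ≤ 1 * M := by
    rw [abs_mul]; exact mul_le_mul hθ₂ (hg c) (abs_nonneg _) zero_le_one
  have e3 : |-g b| ≤ M := by rw [abs_neg]; exact hg b
  rw [greenBoundary]
  refine (abs_add_le _ _).trans ?_
  have := abs_add_le (-g b) ((S c - S b) / (S c - S a) * g a)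
  linarith

theorem continuousOn_green {S : ℝ → ℝ} {a c b : ℝ} (hb : b ∈ Icc a c)
    (hS : ContinuousOn S (Icc a c)) : ContinuousOn (green S a c b) (Icc a c) := by
  have h1 : ContinuousOn (fun ξ => S (min b ξ)) (Icc a c) :=
    hS.comp (f := fun ξ => min b ξ) (by fun_prop)
      fun ξ hξ => ⟨le_min hb.1 hξ.1, (min_le_left _ _).trans hb.2⟩
  have h2 : ContinuousOn (fun ξ => S (max b ξ)) (Icc a c) :=
    hS.comp (f := fun ξ => max b ξ) (by fun_prop)
      fun ξ hξ => ⟨hb.1.trans (le_max_left _ _), max_le hb.2 hξ.2⟩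
  exact ((h1.sub continuousOn_const).mul (continuousOn_const.sub h2)).div_const _

theorem continuousOn_log_Icc {a c : ℝ} (ha : 0 < a) : ContinuousOn Real.log (Icc a c) :=
  Real.continuousOn_log.mono fun _ hx => (ha.trans_le hx.1).ne'

variable {α T : ℝ} {w : ℝ → ℝ → ℝ → ℝ}

/-- The spatial operator `u_xx + (1/x) u_x + u_yy`. -/
noncomputable def spatial (w : ℝ → ℝ → ℝ → ℝ) (x y t : ℝ) : ℝ :=
  dxx w x y t + (1 / x) * dx w x y t + dyy w x y t

/-- The values of `integral_caputo` at t and at ε are subtracted. Starting at ε > 0 keeps the time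
interval where the space derivatives are continuous, as Fubini will require. -/
theorem integral_spatial (hα₁ : 1 < α) (hα₂ : α < 2)
    (hw : IsContinuousSolution α T (fun _ _ _ => 0) (fun _ _ => 0) (fun _ _ => 0) w)
    {x y : ℝ} (hx : x ∈ Ioo (0 : ℝ) 1) (hy : y ∈ Ioo (0 : ℝ) 1) {ε t : ℝ}
    (hε : ε ∈ Ioo 0 T) (ht : t ∈ Ioo 0 T) :
    ∫ s in ε..t, spatial w x y s = 1 / Real.Gamma (2 - α) *
      ((∫ s in (0 : ℝ)..t, (t - s) ^ (1 - α) * dt w x y s) -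
        ∫ s in (0 : ℝ)..ε, (ε - s) ^ (1 - α) * dt w x y s) := by
  have hcont : ContinuousOn (derivWithin (fun τ => w x y τ) (Ici 0)) (Ico 0 T) :=
    hw.continuousOn_dt.comp (f := fun t : ℝ => (x, y, t)) (by fun_prop) fun t ht => ⟨hx, hy, ht⟩
  have h := fun {t : ℝ} (ht : t ∈ Ioo 0 T) => integral_caputo hα₁ hα₂ hcont
    (hw.initial_velocity x hx y hy) (hw.caputoExists x hx y hy) ht
  have e : ∫ s in ε..t, spatial w x y s = ∫ s in ε..t, caputo α (fun τ => w x y τ) s := by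
    refine intervalIntegral.integral_congr fun s hs => ?_
    have hs' : s ∈ Ioo 0 T := (ordConnected_Ioo.uIcc_subset hε ht) hs
    simp only [spatial]
    rw [hw.equation x hx y hy s hs', add_zero]
  rw [e, ← intervalIntegral.integral_interval_sub_left (h ht).1 (h hε).1, (h ht).2, (h hε).2]
  exact (mul_sub _ _ _).symm

end Rectangle

/-! ### Green functions tested against the spatial operator -/

section RectangleIdentity

variable {α T : ℝ} {w : ℝ → ℝ → ℝ → ℝ} {a c b d : ℝ}

theorem integral_green_dyy
    (hw : IsContinuousSolution α T (fun _ _ _ => 0) (fun _ _ => 0) (fun _ _ => 0) w)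
    (ha : 0 < a) (hc : c < 1) (hac : a < c) (hd : d ∈ Icc a c) {x s : ℝ} (hx : x ∈ Ioo (0 : ℝ) 1)
    (hs : s ∈ Ioo 0 T) :
    ∫ η in Icc a c, green id a c d η * dyy w x η s =
      greenBoundary id a c d (fun η => w x η s) := by
  have hsub : ∀ η ∈ Icc a c, η ∈ Ioo (0 : ℝ) 1 := fun η hη =>
    ⟨ha.trans_le hη.1, hη.2.trans_lt hc⟩
  rw [integral_Icc_eq_integral_Ioc, ← intervalIntegral.integral_of_le hac.le]
  refine integral_green_mul (S' := fun _ => 1) (m := fun η => dy w x η s)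
    (w := fun η => w x η s) hd.1 hd.2 (sub_ne_zero.2 hac.ne') (fun η _ => hasDerivAt_id η)
    (fun η hη => (hw.differentiable_y x hx η (hsub η hη) s hs).2.hasDerivAt) ?_
    (fun η hη => by
      rw [one_mul]; exact (hw.differentiable_y x hx η (hsub η hη) s hs).1.hasDerivAt)
  exact hw.continuousOn_dyy.comp (f := fun η : ℝ => (x, η, s)) (by fun_prop)
    fun η hη => ⟨hx, hsub η hη, hs⟩

/-- The weight ξ makes the operator a derivative, ξ u_xx + u_x = (ξ u_x)'. With m = ξ u_x and S =
log one has S' m = u_x, as `integral_green_mul` demands. -/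
theorem integral_green_bessel
    (hw : IsContinuousSolution α T (fun _ _ _ => 0) (fun _ _ => 0) (fun _ _ => 0) w)
    (ha : 0 < a) (hc : c < 1) (hac : a < c) (hb : b ∈ Icc a c) {y s : ℝ} (hy : y ∈ Ioo (0 : ℝ) 1)
    (hs : s ∈ Ioo 0 T) :
    ∫ ξ in Icc a c, green Real.log a c b ξ * ξ * (dxx w ξ y s + (1 / ξ) * dx w ξ y s) =
      greenBoundary Real.log a c b (fun ξ => w ξ y s) := by
  have hpos : ∀ ξ ∈ Icc a c, 0 < ξ := fun ξ hξ => ha.trans_le hξ.1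
  have hsub : ∀ ξ ∈ Icc a c, ξ ∈ Ioo (0 : ℝ) 1 := fun ξ hξ => ⟨hpos ξ hξ, hξ.2.trans_lt hc⟩
  have h := integral_green_mul (S := Real.log) (S' := fun ξ => ξ⁻¹) (m := fun ξ => ξ * dx w ξ y s)
    (m' := fun ξ => 1 * dx w ξ y s + ξ * dxx w ξ y s)
    (w := fun ξ => w ξ y s) hb.1 hb.2 (sub_pos.2 (Real.log_lt_log ha hac)).ne'
    (fun ξ hξ => Real.hasDerivAt_log (hpos ξ hξ).ne')
    (fun ξ hξ => (hasDerivAt_id ξ).mul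
      (hw.differentiable_x ξ (hsub ξ hξ) y hy s hs).2.hasDerivAt) ?_
    (fun ξ hξ => by
      rw [inv_mul_cancel_left₀ (hpos ξ hξ).ne']
      exact (hw.differentiable_x ξ (hsub ξ hξ) y hy s hs).1.hasDerivAt)
  · rw [greenBoundary, ← h, intervalIntegral.integral_of_le hac.le, integral_Icc_eq_integral_Ioc]
    refine setIntegral_congr_fun measurableSet_Ioc fun ξ hξ => ?_
    have := (hpos ξ (Ioc_subset_Icc_self hξ)).ne'
    field_simp
    ring
  · have h1 : ContinuousOn (fun ξ => dx w ξ y s) (Icc a c) :=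
      hw.continuousOn_dx.comp (f := fun ξ : ℝ => (ξ, y, s)) (by fun_prop)
        fun ξ hξ => ⟨hsub ξ hξ, hy, hs⟩
    have h2 : ContinuousOn (fun ξ => dxx w ξ y s) (Icc a c) :=
      hw.continuousOn_dxx.comp (f := fun ξ : ℝ => (ξ, y, s)) (by fun_prop)
        fun ξ hξ => ⟨hsub ξ hξ, hy, hs⟩
    fun_prop

/-- The product Green function, with the weight `x` of the singular operator. -/
noncomputable def greenWeight (a c b d : ℝ) (z : ℝ × ℝ) : ℝ :=
  green Real.log a c b z.1 * z.1 * green id a c d z.2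

theorem continuousOn_greenWeight (ha : 0 < a) (hb : b ∈ Icc a c) (hd : d ∈ Icc a c) :
    ContinuousOn (greenWeight a c b d) (Icc a c ×ˢ Icc a c) := by
  have h1 : ContinuousOn (fun z : ℝ × ℝ => green Real.log a c b z.1) (Icc a c ×ˢ Icc a c) :=
    (continuousOn_green hb (continuousOn_log_Icc ha)).comp continuousOn_fst fun z hz => hz.1
  have h2 : ContinuousOn (fun z : ℝ × ℝ => green id a c d z.2) (Icc a c ×ˢ Icc a c) :=
    (continuousOn_green hd continuousOn_id).comp continuousOn_snd fun z hz => hz.2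
  exact (h1.mul continuousOn_fst).mul h2

/-- The sum of the boundary terms, integrated against the Green functions. -/
noncomputable def boundaryTerm (a c b d : ℝ) (w : ℝ → ℝ → ℝ → ℝ) (s : ℝ) : ℝ :=
  (∫ η in Icc a c, green id a c d η * greenBoundary Real.log a c b (fun ξ => w ξ η s)) +
    ∫ ξ in Icc a c, green Real.log a c b ξ * ξ * greenBoundary id a c d (fun η => w ξ η s)

/-- Fubini in opposite orders for the two parts: the x-part is integrated in x first, u_yy in y
first. -/
theorem integral_greenWeight_spatial
    (hw : IsContinuousSolution α T (fun _ _ _ => 0) (fun _ _ => 0) (fun _ _ => 0) w)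
    (ha : 0 < a) (hc : c < 1) (hac : a < c) (hb : b ∈ Icc a c) (hd : d ∈ Icc a c) {s : ℝ}
    (hs : s ∈ Ioo 0 T) :
    ∫ z in Icc a c ×ˢ Icc a c, greenWeight a c b d z * spatial w z.1 z.2 s =
      boundaryTerm a c b d w s := by
  have hsub : ∀ ξ ∈ Icc a c, ξ ∈ Ioo (0 : ℝ) 1 := fun ξ hξ =>
    ⟨ha.trans_le hξ.1, hξ.2.trans_lt hc⟩
  have hcomp : IsCompact (Icc a c ×ˢ Icc a c) := isCompact_Icc.prod isCompact_Icc
  have hmaps : MapsTo (fun z : ℝ × ℝ => (z.1, z.2, s)) (Icc a c ×ˢ Icc a c) (OmegaInt T) :=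
    fun z hz => ⟨hsub _ hz.1, hsub _ hz.2, hs⟩
  have hg := continuousOn_greenWeight ha hb hd
  have hx0 : ∀ z ∈ Icc a c ×ˢ Icc a c, z.1 ≠ 0 := fun z hz => (ha.trans_le hz.1.1).ne'
  have c1 : ContinuousOn (fun z : ℝ × ℝ => greenWeight a c b d z *
      (dxx w z.1 z.2 s + (1 / z.1) * dx w z.1 z.2 s)) (Icc a c ×ˢ Icc a c) :=
    hg.mul ((hw.continuousOn_dxx.comp (by fun_prop) hmaps).add
      ((continuousOn_const.div continuousOn_fst hx0).mul
        (hw.continuousOn_dx.comp (by fun_prop) hmaps)))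
  have c2 : ContinuousOn (fun z : ℝ × ℝ => greenWeight a c b d z * dyy w z.1 z.2 s)
      (Icc a c ×ˢ Icc a c) := hg.mul (hw.continuousOn_dyy.comp (by fun_prop) hmaps)
  have i1 := c1.integrableOn_compact hcomp (μ := volume)
  have i2 := c2.integrableOn_compact hcomp (μ := volume)
  have hsplit : ∀ z : ℝ × ℝ, greenWeight a c b d z * spatial w z.1 z.2 s =
      greenWeight a c b d z * (dxx w z.1 z.2 s + (1 / z.1) * dx w z.1 z.2 s) +
        greenWeight a c b d z * dyy w z.1 z.2 s := fun z => mul_add _ _ _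
  simp_rw [hsplit]
  rw [integral_add i1 i2]
  rw [boundaryTerm]
  congr 1
  · rw [Measure.volume_eq_prod, ← Measure.prod_restrict, integral_prod_symm]
    · refine setIntegral_congr_fun measurableSet_Icc fun η hη => ?_
      simp only [greenWeight]
      rw [← integral_green_bessel hw ha hc hac hb (hsub η hη) hs, ← integral_const_mul]
      congr! 2 with ξ
      ring
    · rwa [Measure.prod_restrict, ← Measure.volume_eq_prod]
  · rw [Measure.volume_eq_prod, setIntegral_prod _ i2]
    refine setIntegral_congr_fun measurableSet_Icc fun ξ hξ => ?_
    simp only [greenWeight]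
    rw [← integral_green_dyy hw ha hc hac hd (hsub ξ hξ) hs, ← integral_const_mul]
    simp_rw [mul_assoc]

theorem abs_greenBoundary_log_le (ha : 0 < a) (hb : b ∈ Icc a c) {M : ℝ} {g : ℝ → ℝ}
    (hg : ∀ x, |g x| ≤ M) : |greenBoundary Real.log a c b g| ≤ 3 * M :=
  abs_greenBoundary_le (Real.log_le_log ha hb.1) (Real.log_le_log (ha.trans_le hb.1) hb.2) hg

theorem abs_greenBoundary_id_le (hb : b ∈ Icc a c) {M : ℝ} {g : ℝ → ℝ}
    (hg : ∀ x, |g x| ≤ M) : |greenBoundary id a c b g| ≤ 3 * M :=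
  abs_greenBoundary_le hb.1 hb.2 hg

theorem continuous_boundaryTerm (ha : 0 < a) (hb : b ∈ Icc a c) (hd : d ∈ Icc a c)
    {W : ℝ → ℝ → ℝ → ℝ} {M : ℝ} (hW : Continuous fun p : ℝ × ℝ × ℝ => W p.1 p.2.1 p.2.2)
    (hM : ∀ x y t, |W x y t| ≤ M) : Continuous (boundaryTerm a c b d W) := by
  have i1 : IntegrableOn (green id a c d) (Icc a c) :=
    (continuousOn_green hd continuousOn_id).integrableOn_compact isCompact_Icc
  have i2 : IntegrableOn (fun ξ => green Real.log a c b ξ * ξ) (Icc a c) :=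
    ((continuousOn_green hb (continuousOn_log_Icc ha)).mul
      continuousOn_id).integrableOn_compact isCompact_Icc
  refine Continuous.add ?_ ?_
  · refine continuous_integral_mul (M := 3 * M)
      (F := fun s η => greenBoundary Real.log a c b fun ξ => W ξ η s) i1 ?_
      fun s η => abs_greenBoundary_log_le ha hb fun ξ => hM _ _ _
    simp only [greenBoundary]
    fun_prop
  · refine continuous_integral_mul (M := 3 * M)
      (F := fun s ξ => greenBoundary id a c d fun η => W ξ η s) i2 ?_
      fun s η => abs_greenBoundary_id_le hd fun ξ => hM _ _ _
    simp only [greenBoundary]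
    fun_prop

theorem boundaryTerm_congr (ha : 0 < a) (hc : c < 1) (hac : a < c) (hb : b ∈ Icc a c)
    (hd : d ∈ Icc a c) {W : ℝ → ℝ → ℝ → ℝ} {s : ℝ}
    (hWw : ∀ x ∈ Icc (0 : ℝ) 1, ∀ y ∈ Icc (0 : ℝ) 1, W x y s = w x y s) :
    boundaryTerm a c b d W s = boundaryTerm a c b d w s := by
  have hsub : ∀ ξ ∈ Icc a c, ξ ∈ Icc (0 : ℝ) 1 := fun ξ hξ =>
    ⟨ha.le.trans hξ.1, hξ.2.trans hc.le⟩
  have hA := hsub a ⟨le_rfl, hac.le⟩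
  have hC := hsub c ⟨hac.le, le_rfl⟩
  simp only [boundaryTerm]
  congr 1
  · refine setIntegral_congr_fun measurableSet_Icc fun η hη => ?_
    simp only [greenBoundary, hWw a hA η (hsub η hη), hWw b (hsub b hb) η (hsub η hη),
      hWw c hC η (hsub η hη)]
  · refine setIntegral_congr_fun measurableSet_Icc fun ξ hξ => ?_
    simp only [greenBoundary, hWw ξ (hsub ξ hξ) a hA, hWw ξ (hsub ξ hξ) d (hsub d hd),
      hWw ξ (hsub ξ hξ) c hC]

end RectangleIdentity

/-! ### The identity on a rectangle, free of derivatives -/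

section RectangleIdentity

variable {α T : ℝ} {w : ℝ → ℝ → ℝ → ℝ} {a c b d : ℝ}

/-- Fractional integrals of bounded functions tend to zero at the origin. -/
theorem tendsto_rpow_volterra_zero {α t M : ℝ} (hα₂ : α < 2) (ht : 0 < t) {g : ℝ → ℝ}
    (hM : ∀ s ∈ Icc 0 t, |g s| ≤ M) :
    Tendsto (fun ε => ∫ s in (0 : ℝ)..ε, (ε - s) ^ (1 - α) * g s) (𝓝[>] 0) (𝓝 0) := by
  have hb : ∀ ε ∈ Ioo 0 t, |∫ s in (0 : ℝ)..ε, (ε - s) ^ (1 - α) * g s| ≤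
      betaConst (1 - α) 0 * ε ^ (2 - α) * M := by
    intro ε hε
    have h1 := integral_rpow_mul_rpow (1 - α) 0 hε.1
    have h2 := intervalIntegrable_rpow_mul_rpow (a := 1 - α) (b := 0) (by linarith) (by norm_num)
      hε.1
    simp only [Real.rpow_zero, mul_one, sub_zero] at h1 h2
    rw [show 2 - α = 1 - α + 0 + 1 by ring, ← h1, ← intervalIntegral.integral_mul_const]
    refine intervalIntegral.norm_integral_le_of_norm_le (μ := volume)
      (f := fun s => (ε - s) ^ (1 - α) * g s) (g := fun s => (ε - s) ^ (1 - α) * M) hε.1.le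
      (Eventually.of_forall ?_) (h2.mul_const M)
    intro s hs
    rw [Real.norm_eq_abs, abs_mul, abs_of_nonneg (Real.rpow_nonneg (by linarith [hs.2]) _)]
    exact mul_le_mul_of_nonneg_left (hM s ⟨hs.1.le, hs.2.trans hε.2.le⟩)
      (Real.rpow_nonneg (by linarith [hs.2]) _)
  have hlim : Tendsto (fun ε : ℝ => betaConst (1 - α) 0 * ε ^ (2 - α) * M) (𝓝[>] 0) (𝓝 0) := by
    have h : Continuous fun ε : ℝ => betaConst (1 - α) 0 * ε ^ (2 - α) * M :=
      (continuous_const.mul (Real.continuous_rpow_const (by linarith))).mul continuous_const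
    have h0 := h.tendsto 0
    rw [Real.zero_rpow (by linarith), mul_zero, zero_mul] at h0
    exact h0.mono_left nhdsWithin_le_nhds
  refine squeeze_zero_norm' ?_ hlim
  filter_upwards [Ioo_mem_nhdsGT ht] with ε hε using hb ε hε

theorem integral_dt
    (hw : IsContinuousSolution α T (fun _ _ _ => 0) (fun _ _ => 0) (fun _ _ => 0) w)
    {x y t : ℝ} (hx : x ∈ Ioo (0 : ℝ) 1) (hy : y ∈ Ioo (0 : ℝ) 1) (ht : t ∈ Ioo 0 T) :
    ∫ s in (0 : ℝ)..t, dt w x y s = w x y t := by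
  have hx' := Ioo_subset_Icc_self hx
  have hy' := Ioo_subset_Icc_self hy
  have hc : ContinuousOn (fun s => w x y s) (Icc 0 t) :=
    hw.continuousOn.comp (f := fun s : ℝ => (x, y, s)) (by fun_prop)
      fun s hs => ⟨hx', hy', hs.1, hs.2.trans ht.2.le⟩
  have hc' : ContinuousOn (fun s => dt w x y s) (Icc 0 t) :=
    hw.continuousOn_dt.comp (f := fun s : ℝ => (x, y, s)) (by fun_prop)
      fun s hs => ⟨hx, hy, hs.1, hs.2.trans_lt ht.2⟩
  rw [intervalIntegral.integral_eq_sub_of_hasDerivAt_of_le ht.1.le hc (fun s hs => ?_)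
    (ContinuousOn.intervalIntegrable (by rwa [uIcc_of_le ht.1.le])),
    hw.initial_value x hx' y hy', sub_zero]
  exact (hw.differentiable_t x hx y hy s
    ⟨hs.1.le, hs.2.trans ht.2⟩).hasDerivWithinAt.hasDerivAt (Ici_mem_nhds hs.1)

/-- The weak form of the equation, tested against a product of Green functions. -/
theorem rectangle_identity (hα₁ : 1 < α) (hα₂ : α < 2)
    (hw : IsContinuousSolution α T (fun _ _ _ => 0) (fun _ _ => 0) (fun _ _ => 0) w)
    (ha : 0 < a) (hc : c < 1) (hac : a < c) (hb : b ∈ Icc a c) (hd : d ∈ Icc a c)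
    {W : ℝ → ℝ → ℝ → ℝ} {M : ℝ} (hW : Continuous fun p : ℝ × ℝ × ℝ => W p.1 p.2.1 p.2.2)
    (hM : ∀ x y t, |W x y t| ≤ M)
    (hWw : ∀ x ∈ Icc (0 : ℝ) 1, ∀ y ∈ Icc (0 : ℝ) 1, ∀ t ∈ Icc 0 T, W x y t = w x y t)
    {t : ℝ} (ht : t ∈ Ioo 0 T) :
    1 / Real.Gamma (2 - α) * betaConst (α - 2) (1 - α) *
      ∫ z in Icc a c ×ˢ Icc a c, greenWeight a c b d z * W z.1 z.2 t =
    betaConst (α - 2) 0 *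
      ∫ s in (0 : ℝ)..t, (t - s) ^ (α - 1) * boundaryTerm a c b d W s := by
  have hcomp : IsCompact (Icc a c ×ˢ Icc a c) := isCompact_Icc.prod isCompact_Icc
  have hsub : ∀ ξ ∈ Icc a c, ξ ∈ Ioo (0 : ℝ) 1 := fun ξ hξ =>
    ⟨ha.trans_le hξ.1, hξ.2.trans_lt hc⟩
  have hg := continuousOn_greenWeight ha hb hd
  have hrc := continuous_boundaryTerm (c := c) ha hb hd hW hM
  have hr : ∀ s ∈ Ioo 0 T, boundaryTerm a c b d W s =
      ∫ z in Icc a c ×ˢ Icc a c, greenWeight a c b d z * spatial w z.1 z.2 s := fun s hs => by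
    rw [integral_greenWeight_spatial hw ha hc hac hb hd hs]
    exact boundaryTerm_congr ha hc hac hb hd
      fun x hx y hy => hWw x hx y hy s (Ioo_subset_Icc_self hs)
  -- The time derivative is continuous up to t = 0, whereas the space derivatives in `csp` are
  -- controlled only from ε > 0 on.
  have cdt : ∀ {t}, t ∈ Ioo 0 T → ContinuousOn
      (fun p : (ℝ × ℝ) × ℝ => greenWeight a c b d p.1 * dt w p.1.1 p.1.2 p.2)
      ((Icc a c ×ˢ Icc a c) ×ˢ Icc 0 t) := fun {t} ht =>
    (hg.comp continuousOn_fst fun p hp => hp.1).mul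
      (hw.continuousOn_dt.comp (f := fun p : (ℝ × ℝ) × ℝ => (p.1.1, p.1.2, p.2)) (by fun_prop)
        fun p hp => ⟨hsub _ hp.1.1, hsub _ hp.1.2, hp.2.1, hp.2.2.trans_lt ht.2⟩)
  have csp : ∀ {ε t}, ε ∈ Ioo 0 T → t ∈ Ioo 0 T → ContinuousOn
      (fun p : (ℝ × ℝ) × ℝ => greenWeight a c b d p.1 * spatial w p.1.1 p.1.2 p.2)
      ((Icc a c ×ˢ Icc a c) ×ˢ Icc ε t) := fun {ε t} hε ht => by
    have hmaps : MapsTo (fun p : (ℝ × ℝ) × ℝ => (p.1.1, p.1.2, p.2))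
        ((Icc a c ×ˢ Icc a c) ×ˢ Icc ε t) (OmegaInt T) := fun p hp =>
      ⟨hsub _ hp.1.1, hsub _ hp.1.2, hε.1.trans_le hp.2.1, hp.2.2.trans_lt ht.2⟩
    refine (hg.comp continuousOn_fst fun p hp => hp.1).mul ?_
    refine ((hw.continuousOn_dxx.comp (by fun_prop) hmaps).add
      ((continuousOn_const.div (by fun_prop) fun p hp => (hsub _ hp.1.1).1.ne').mul
        (hw.continuousOn_dx.comp (by fun_prop) hmaps))).add
        (hw.continuousOn_dyy.comp (by fun_prop) hmaps)
  set D : ℝ → ℝ := fun s => ∫ z in Icc a c ×ˢ Icc a c, greenWeight a c b d z * dt w z.1 z.2 s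
    with hD
  have ik : ∀ t : ℝ, IntervalIntegrable (fun s => (t - s) ^ (1 - α)) volume 0 t := fun t => by
    have := (intervalIntegral.intervalIntegrable_rpow' (r := 1 - α) (a := t) (b := 0)
      (by linarith)).comp_sub_left t
    simpa using this
  have hI := fun {t : ℝ} (ht : t ∈ Ioo 0 T) => integral_time_swap hcomp ht.1.le (ik t)
    (F := fun z s => greenWeight a c b d z * dt w z.1 z.2 s) (cdt ht)
  have h1 := fun {t : ℝ} (ht : t ∈ Ioo 0 T) => integral_time_swap hcomp ht.1.le
    (intervalIntegrable_const (c := (1 : ℝ)))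
    (F := fun z s => greenWeight a c b d z * dt w z.1 z.2 s) (cdt ht)
  simp only [one_mul] at h1
  have hdiff : ∀ ε ∈ Ioo 0 T, ∀ t ∈ Ioo 0 T, ε ≤ t → ∫ s in ε..t, boundaryTerm a c b d W s =
      1 / Real.Gamma (2 - α) * ((∫ s in (0 : ℝ)..t, (t - s) ^ (1 - α) * D s) -
        ∫ s in (0 : ℝ)..ε, (ε - s) ^ (1 - α) * D s) := by
    intro ε hε t ht hεt
    have hs := integral_time_swap hcomp hεt (intervalIntegrable_const (c := (1 : ℝ)))
      (F := fun z s => greenWeight a c b d z * spatial w z.1 z.2 s) (csp hε ht)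
    simp only [one_mul] at hs
    rw [(hI ht).2.2, (hI hε).2.2, ← integral_sub (hI ht).2.1 (hI hε).2.1, ← integral_const_mul,
      intervalIntegral.integral_congr fun s hs => hr s (ordConnected_Ioo.uIcc_subset hε ht hs),
      hs.2.2]
    refine setIntegral_congr_fun hcomp.measurableSet fun z hz => ?_
    simp only [mul_left_comm _ (greenWeight a c b d z), intervalIntegral.integral_const_mul]
    rw [integral_spatial hα₁ hα₂ hw (hsub _ hz.1) (hsub _ hz.2) hε ht]
    ring
  -- The cut-off ε tends to 0. The boundary terms involve only the continuous W, so their integral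
  -- extends to 0, and the Abel integral up to ε vanishes because D is bounded.
  have hrel : ∀ t ∈ Ioo 0 T, 1 / Real.Gamma (2 - α) *
      (∫ s in (0 : ℝ)..t, (t - s) ^ (1 - α) * D s) =
      ∫ s in (0 : ℝ)..t, boundaryTerm a c b d W s := by
    intro t ht
    obtain ⟨N, hN⟩ := (hcomp.prod isCompact_Icc).exists_bound_of_continuousOn (cdt ht)
    have hDb : ∀ s ∈ Icc 0 t,
        |D s| ≤ N * (volume : Measure (ℝ × ℝ)).real (Icc a c ×ˢ Icc a c) := fun s hs =>
      norm_setIntegral_le_of_norm_le_const hcomp.measure_lt_top fun z hz => hN (z, s) ⟨hz, hs⟩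
    have l1 : Tendsto (fun ε => 1 / Real.Gamma (2 - α) *
        ((∫ s in (0 : ℝ)..t, (t - s) ^ (1 - α) * D s) -
        ∫ s in (0 : ℝ)..ε, (ε - s) ^ (1 - α) * D s)) (𝓝[>] 0)
        (𝓝 (1 / Real.Gamma (2 - α) *
          ((∫ s in (0 : ℝ)..t, (t - s) ^ (1 - α) * D s) - 0))) :=
      (tendsto_const_nhds.sub (tendsto_rpow_volterra_zero hα₂ ht.1 hDb)).const_mul _
    have l2 : Tendsto (fun ε => ∫ s in ε..t, boundaryTerm a c b d W s) (𝓝[>] 0)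
        (𝓝 (∫ s in (0 : ℝ)..t, boundaryTerm a c b d W s)) := by
      have : Continuous fun ε => ∫ s in ε..t, boundaryTerm a c b d W s := by
        simp_rw [intervalIntegral.integral_symm t]
        exact (intervalIntegral.continuous_primitive
          (fun a b => hrc.intervalIntegrable a b) t).neg
      exact (this.tendsto 0).mono_left nhdsWithin_le_nhds
    rw [sub_zero] at l1
    refine tendsto_nhds_unique l1 (l2.congr' ?_)
    filter_upwards [Ioo_mem_nhdsGT ht.1] with ε hε
    exact hdiff ε ⟨hε.1, hε.2.trans ht.2⟩ t ht hε.2.le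
  -- Inversion leaves the time integral of D, which is the weighted space integral of w(t) because w
  -- starts from 0.
  have hfinal := abel_inversion hα₁ hα₂ ht.1.le (h1 ht).1 (hrc.intervalIntegrable 0 t)
    fun s hs => hrel s ⟨hs.1, hs.2.trans ht.2⟩
  rw [← hfinal, (h1 ht).2.2]
  congr 1
  refine setIntegral_congr_fun hcomp.measurableSet fun z hz => ?_
  simp only [intervalIntegral.integral_const_mul]
  rw [integral_dt hw (hsub _ hz.1) (hsub _ hz.2) ht, hWw _ (Ioo_subset_Icc_self (hsub _ hz.1)) _
    (Ioo_subset_Icc_self (hsub _ hz.2)) t (Ioo_subset_Icc_self ht)]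

end RectangleIdentity

/-! ### Exhausting the square by rectangles -/

section Exhaustion

/-- Dominated convergence along an exhaustion. -/
theorem tendsto_setIntegral_exhaustion {ι E : Type*} [MeasurableSpace E] {μ : Measure E}
    {l : Filter ι} [l.IsCountablyGenerated] {K : ι → Set E} {U : Set E} {F : ι → E → ℝ}
    {F' : E → ℝ} {C : ℝ} (hU : MeasurableSet U) (hμU : μ U ≠ ⊤)
    (hKm : ∀ i, MeasurableSet (K i)) (hKU : ∀ᶠ i in l, K i ⊆ U)
    (hex : ∀ x ∈ U, ∀ᶠ i in l, x ∈ K i)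
    (hF : ∀ᶠ i in l, AEStronglyMeasurable (F i) (μ.restrict (K i)))
    (hC : ∀ᶠ i in l, ∀ x ∈ K i, |F i x| ≤ C)
    (hlim : ∀ x ∈ U, Tendsto (fun i => F i x) l (𝓝 (F' x))) :
    Tendsto (fun i => ∫ x in K i, F i x ∂μ) l (𝓝 (∫ x in U, F' x ∂μ)) := by
  -- The dominating constant must also be nonnegative off K i, where the extended integrand is 0.
  have hC' : ∀ᶠ i in l, ∀ x ∈ K i, |F i x| ≤ |C| := hC.mono fun i h x hx =>
    (h x hx).trans (le_abs_self C)
  have h : Tendsto (fun i => ∫ x in U, (K i).indicator (F i) x ∂μ) l (𝓝 (∫ x in U, F' x ∂μ)) := by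
    refine tendsto_integral_filter_of_dominated_convergence (fun _ => |C|) ?_ ?_
      (integrableOn_const hμU) ?_
    · filter_upwards [hF, hKU] with i hi hs
      rw [aestronglyMeasurable_indicator_iff (hKm i), Measure.restrict_restrict (hKm i),
        inter_eq_left.2 hs]
      exact hi
    · filter_upwards [hC'] with i hi
      refine Eventually.of_forall fun x => ?_
      by_cases hx : x ∈ K i
      · rw [indicator_of_mem hx]; exact hi x hx
      · rw [indicator_of_notMem hx, norm_zero]; exact abs_nonneg _
    · filter_upwards [ae_restrict_mem hU] with x hx
      refine (hlim x hx).congr' ?_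
      filter_upwards [hex x hx] with i hi
      rw [indicator_of_mem hi]
  refine h.congr' ?_
  filter_upwards [hKU] with i hi
  rw [setIntegral_indicator (hKm i), inter_eq_right.2 hi]

/-- The first factor divided by S c - S a is at most 1. The bound is independent of a, which is
essential for S = log as a tends to 0. -/
theorem abs_green_le {S : ℝ → ℝ} {a c b ξ : ℝ} (hS : MonotoneOn S (Icc a c)) (hb : b ∈ Icc a c)
    (hξ : ξ ∈ Icc a c) : |green S a c b ξ| ≤ S c - S b := by
  have hac := hb.1.trans hb.2
  have hA : a ∈ Icc a c := ⟨le_rfl, hac⟩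
  have hC : c ∈ Icc a c := ⟨hac, le_rfl⟩
  have hmin : min b ξ ∈ Icc a c := ⟨le_min hb.1 hξ.1, (min_le_left _ _).trans hb.2⟩
  have hmax : max b ξ ∈ Icc a c := ⟨hb.1.trans (le_max_left _ _), max_le hb.2 hξ.2⟩
  have h1 := hS hA hmin hmin.1
  have h2 := hS hmin hC hmin.2
  have h3 := hS hb hmax (le_max_left _ _)
  have h4 := hS hmax hC hmax.2
  have h5 : (S (min b ξ) - S a) / (S c - S a) ≤ 1 :=
    div_le_one_of_le₀ (by linarith) (by linarith)
  have h6 : 0 ≤ (S (min b ξ) - S a) / (S c - S a) := div_nonneg (by linarith) (by linarith)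
  rw [green, mul_div_right_comm, abs_of_nonneg (mul_nonneg h6 (by linarith))]
  calc _ ≤ 1 * (S c - S (max b ξ)) := mul_le_mul_of_nonneg_right h5 (by linarith)
    _ ≤ S c - S b := by linarith

theorem tendsto_one_sub_nhdsGT : Tendsto (fun ε : ℝ => 1 - ε) (𝓝[>] 0) (𝓝 1) := by
  have : Continuous fun ε : ℝ => 1 - ε := by fun_prop
  simpa using (this.tendsto 0).mono_left nhdsWithin_le_nhds

theorem tendsto_log_one_sub : Tendsto (fun ε : ℝ => Real.log (1 - ε)) (𝓝[>] 0) (𝓝 0) := by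
  have := (Real.continuousAt_log one_ne_zero).tendsto.comp tendsto_one_sub_nhdsGT
  rw [Real.log_one] at this
  exact this

theorem tendsto_log_sub_log :
    Tendsto (fun ε : ℝ => Real.log (1 - ε) - Real.log ε) (𝓝[>] 0) atTop := by
  simp_rw [sub_eq_add_neg (Real.log _)]
  exact tendsto_log_one_sub.add_atTop (tendsto_neg_atBot_atTop.comp Real.tendsto_log_nhdsGT_zero)

theorem tendsto_log_ratio (x : ℝ) : Tendsto (fun ε : ℝ =>
    (x - Real.log ε) / (Real.log (1 - ε) - Real.log ε)) (𝓝[>] 0) (𝓝 1) := by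
  have h : Tendsto (fun ε : ℝ => 1 - (Real.log (1 - ε) - x) / (Real.log (1 - ε) - Real.log ε))
      (𝓝[>] 0) (𝓝 (1 - 0)) :=
    tendsto_const_nhds.sub ((tendsto_log_one_sub.sub_const x).div_atTop tendsto_log_sub_log)
  rw [sub_zero] at h
  refine h.congr' ?_
  filter_upwards [tendsto_log_sub_log.eventually_gt_atTop 0] with ε hε
  field_simp
  ring

theorem tendsto_green_log (b ξ : ℝ) :
    Tendsto (fun ε : ℝ => green Real.log ε (1 - ε) b ξ) (𝓝[>] 0)
      (𝓝 (-Real.log (max b ξ))) := by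
  simp only [green, mul_div_right_comm]
  have := (tendsto_log_ratio (Real.log (min b ξ))).mul
    (tendsto_log_one_sub.sub_const (Real.log (max b ξ)))
  simpa using this

theorem tendsto_green_id (d η : ℝ) :
    Tendsto (fun ε : ℝ => green id ε (1 - ε) d η) (𝓝[>] 0) (𝓝 (min d η * (1 - max d η))) := by
  have h : ContinuousAt (fun ε : ℝ => green id ε (1 - ε) d η) 0 := by
    simp only [green, id]
    fun_prop (disch := norm_num)
  have h0 := h.tendsto
  simp only [green, id, sub_zero, div_one] at h0
  exact h0.mono_left nhdsWithin_le_nhds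

/-- The coefficient of g ε has denominator log (1 - ε) - log ε, which tends to infinity, so the
contribution of the singular end x = 0 disappears. At the other end the coefficient tends to 1 and g
1 = 0. -/
theorem tendsto_greenBoundary_log (b : ℝ) {g : ℝ → ℝ} (hg : Continuous g) (h1 : g 1 = 0) :
    Tendsto (fun ε : ℝ => greenBoundary Real.log ε (1 - ε) b g) (𝓝[>] 0) (𝓝 (-g b)) := by
  simp only [greenBoundary]
  have e1 : Tendsto (fun ε : ℝ => (Real.log (1 - ε) - Real.log b) /
      (Real.log (1 - ε) - Real.log ε) * g ε) (𝓝[>] 0) (𝓝 (0 * g 0)) :=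
    ((tendsto_log_one_sub.sub_const _).div_atTop tendsto_log_sub_log).mul
      ((hg.tendsto 0).mono_left nhdsWithin_le_nhds)
  have e2 : Tendsto (fun ε : ℝ => (Real.log b - Real.log ε) /
      (Real.log (1 - ε) - Real.log ε) * g (1 - ε)) (𝓝[>] 0) (𝓝 (1 * g 1)) :=
    (tendsto_log_ratio _).mul ((hg.tendsto 1).comp tendsto_one_sub_nhdsGT)
  simpa [h1] using (tendsto_const_nhds (x := -g b)).add (e1.add e2) |>.congr
    fun ε => (add_assoc _ _ _).symm

theorem tendsto_greenBoundary_id (d : ℝ) {g : ℝ → ℝ} (hg : Continuous g) (h0 : g 0 = 0)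
    (h1 : g 1 = 0) :
    Tendsto (fun ε : ℝ => greenBoundary id ε (1 - ε) d g) (𝓝[>] 0) (𝓝 (-g d)) := by
  have h : ContinuousAt (fun ε : ℝ => greenBoundary id ε (1 - ε) d g) 0 := by
    simp only [greenBoundary, id]
    fun_prop (disch := norm_num)
  have h2 := h.tendsto
  simp only [greenBoundary, id, sub_zero, h0, h1, mul_zero, add_zero] at h2
  exact h2.mono_left nhdsWithin_le_nhds

variable {α T : ℝ} {w : ℝ → ℝ → ℝ → ℝ} {b d : ℝ}

theorem eventually_mem_Icc {b : ℝ} (hb : b ∈ Ioo (0 : ℝ) 1) :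
    ∀ᶠ ε in 𝓝[>] (0 : ℝ), b ∈ Icc ε (1 - ε) := by
  filter_upwards [Ioo_mem_nhdsGT hb.1, Ioo_mem_nhdsGT (sub_pos.2 hb.2)] with ε h1 h2
  exact ⟨h1.2.le, by linarith [h2.2]⟩

theorem abs_green_log_mul_le {a c ξ : ℝ} (ha : 0 < a) (hc : c ≤ 1) (hb : b ∈ Icc a c)
    (hξ : ξ ∈ Icc a c) : |green Real.log a c b ξ * ξ| ≤ -Real.log b := by
  have hpos : ∀ x ∈ Icc a c, 0 < x := fun x hx => ha.trans_le hx.1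
  have h := abs_green_le (fun x hx y _ hxy => Real.log_le_log (hpos x hx) hxy) hb hξ
  have hc0 : Real.log c ≤ 0 :=
    Real.log_nonpos ((hpos b hb).le.trans hb.2) hc
  rw [abs_mul, abs_of_pos (hpos ξ hξ)]
  calc _ ≤ |green Real.log a c b ξ| * 1 :=
        mul_le_mul_of_nonneg_left (hξ.2.trans hc) (abs_nonneg _)
    _ ≤ -Real.log b := by linarith

theorem abs_green_id_le {a c η : ℝ} (ha : 0 < a) (hc : c ≤ 1) (hd : d ∈ Icc a c)
    (hη : η ∈ Icc a c) : |green id a c d η| ≤ 1 := by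
  have h := abs_green_le (monotone_id.monotoneOn _) hd hη
  have := hd.1
  simp only [id] at h
  linarith

/-- The limit, as the rectangle exhausts the square, of minus the boundary terms. -/
noncomputable def limitTerm (b d : ℝ) (W : ℝ → ℝ → ℝ → ℝ) (s : ℝ) : ℝ :=
  (∫ η in Ioo (0 : ℝ) 1, min d η * (1 - max d η) * W b η s) +
    ∫ ξ in Ioo (0 : ℝ) 1, -Real.log (max b ξ) * ξ * W ξ d s

theorem tendsto_boundaryTerm (hb : b ∈ Ioo (0 : ℝ) 1) (hd : d ∈ Ioo (0 : ℝ) 1)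
    {W : ℝ → ℝ → ℝ → ℝ} {M : ℝ} (hW : Continuous fun p : ℝ × ℝ × ℝ => W p.1 p.2.1 p.2.2)
    (hM : ∀ x y t, |W x y t| ≤ M) {s : ℝ} (h1 : ∀ y ∈ Ioo (0 : ℝ) 1, W 1 y s = 0)
    (h2 : ∀ x ∈ Ioo (0 : ℝ) 1, W x 0 s = 0) (h3 : ∀ x ∈ Ioo (0 : ℝ) 1, W x 1 s = 0) :
    Tendsto (fun ε : ℝ => boundaryTerm ε (1 - ε) b d W s) (𝓝[>] 0) (𝓝 (-limitTerm b d W s)) := by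
  have hsub : ∀ᶠ ε in 𝓝[>] (0 : ℝ), Icc ε (1 - ε) ⊆ Ioo (0 : ℝ) 1 := by
    filter_upwards [self_mem_nhdsWithin] with ε hε x hx
    exact ⟨lt_of_lt_of_le hε hx.1, by have : (0 : ℝ) < ε := hε; linarith [hx.2]⟩
  rw [limitTerm, neg_add, ← integral_neg, ← integral_neg]
  refine Tendsto.add ?_ ?_
  · refine tendsto_setIntegral_exhaustion (C := 1 * (3 * M)) measurableSet_Ioo (by simp)
      (fun _ => measurableSet_Icc) hsub (fun x hx => eventually_mem_Icc hx) ?_ ?_ ?_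
    · filter_upwards [eventually_mem_Icc hd] with ε hε
      refine (ContinuousOn.mul (continuousOn_green hε continuousOn_id) ?_).aestronglyMeasurable
        measurableSet_Icc
      refine Continuous.continuousOn ?_
      simp only [greenBoundary]
      fun_prop
    · filter_upwards [eventually_mem_Icc hd, eventually_mem_Icc hb, self_mem_nhdsWithin]
        with ε hε hε' hpos η hη
      have hpos' : 0 < ε := hpos
      rw [abs_mul]
      exact mul_le_mul (abs_green_id_le hpos' (by linarith) hε hη)
        (abs_greenBoundary_log_le hpos' hε' fun _ => hM _ _ _) (abs_nonneg _) zero_le_one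
    · intro η hη
      rw [← mul_neg]
      exact (tendsto_green_id d η).mul
        (tendsto_greenBoundary_log b (g := fun ξ => W ξ η s) (by fun_prop) (h1 η hη))
  · refine tendsto_setIntegral_exhaustion (C := -Real.log b * (3 * M)) measurableSet_Ioo (by simp)
      (fun _ => measurableSet_Icc) hsub (fun x hx => eventually_mem_Icc hx) ?_ ?_ ?_
    · filter_upwards [eventually_mem_Icc hb, self_mem_nhdsWithin] with ε hε hpos
      refine (ContinuousOn.mul ((continuousOn_green hε (continuousOn_log_Icc hpos)).mul
        continuousOn_id) ?_).aestronglyMeasurable measurableSet_Icc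
      refine Continuous.continuousOn ?_
      simp only [greenBoundary]
      fun_prop
    · filter_upwards [eventually_mem_Icc hd, eventually_mem_Icc hb, self_mem_nhdsWithin]
        with ε hε hε' hpos ξ hξ
      have hpos' : 0 < ε := hpos
      rw [abs_mul]
      have h := abs_green_log_mul_le hpos' (by linarith) hε' hξ
      exact mul_le_mul h
        (abs_greenBoundary_id_le hε fun _ => hM _ _ _) (abs_nonneg _) ((abs_nonneg _).trans h)
    · intro ξ hξ
      rw [← mul_neg]
      exact ((tendsto_green_log b ξ).mul_const ξ).mul
        (tendsto_greenBoundary_id d (g := fun η => W ξ η s) (by fun_prop) (h2 ξ hξ) (h3 ξ hξ))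

theorem abs_boundaryTerm_le {a c : ℝ} (ha : 0 < a) (hc : c ≤ 1) (hac : a ≤ c) (hb : b ∈ Icc a c)
    (hd : d ∈ Icc a c) {W : ℝ → ℝ → ℝ → ℝ} {M : ℝ} (hM : ∀ x y t, |W x y t| ≤ M) (s : ℝ) :
    |boundaryTerm a c b d W s| ≤ 3 * M + -Real.log b * (3 * M) := by
  have hM0 : 0 ≤ M := (abs_nonneg _).trans (hM 0 0 0)
  have hlog := (abs_nonneg _).trans (abs_green_log_mul_le ha hc hb hb)
  have hv : (volume : Measure ℝ).real (Icc a c) ≤ 1 := by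
    rw [Real.volume_real_Icc_of_le hac]; linarith
  refine (abs_add_le _ _).trans (add_le_add ?_ ?_)
  · refine (norm_setIntegral_le_of_norm_le_const (C := 3 * M) (μ := volume)
      (f := fun η => green id a c d η * greenBoundary Real.log a c b (fun ξ => W ξ η s)) (by simp)
      fun η hη => ?_).trans
      (mul_le_of_le_one_right (by positivity) hv)
    rw [Real.norm_eq_abs, abs_mul, ← one_mul (3 * M)]
    exact mul_le_mul (abs_green_id_le ha hc hd hη)
      (abs_greenBoundary_log_le ha hb fun _ => hM _ _ _) (abs_nonneg _) zero_le_one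
  · refine (norm_setIntegral_le_of_norm_le_const (C := -Real.log b * (3 * M)) (μ := volume)
      (f := fun ξ => green Real.log a c b ξ * ξ * greenBoundary id a c d (fun η => W ξ η s)) (by simp)
      fun ξ hξ => ?_).trans (mul_le_of_le_one_right (by positivity) hv)
    rw [Real.norm_eq_abs, abs_mul]
    exact mul_le_mul (abs_green_log_mul_le ha hc hb hξ)
      (abs_greenBoundary_id_le hd fun _ => hM _ _ _) (abs_nonneg _) hlog

/-- The weak form of the equation, tested against the Green functions of the whole interval. -/
theorem square_identity (hα₁ : 1 < α) (hα₂ : α < 2)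
    (hw : IsContinuousSolution α T (fun _ _ _ => 0) (fun _ _ => 0) (fun _ _ => 0) w)
    (hb : b ∈ Ioo (0 : ℝ) 1) (hd : d ∈ Ioo (0 : ℝ) 1)
    {W : ℝ → ℝ → ℝ → ℝ} {M : ℝ} (hW : Continuous fun p : ℝ × ℝ × ℝ => W p.1 p.2.1 p.2.2)
    (hM : ∀ x y t, |W x y t| ≤ M)
    (hWw : ∀ x ∈ Icc (0 : ℝ) 1, ∀ y ∈ Icc (0 : ℝ) 1, ∀ t ∈ Icc 0 T, W x y t = w x y t)
    {t : ℝ} (ht : t ∈ Ioo 0 T) :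
    1 / Real.Gamma (2 - α) * betaConst (α - 2) (1 - α) *
      ∫ z in Ioo (0 : ℝ) 1 ×ˢ Ioo (0 : ℝ) 1,
        -Real.log (max b z.1) * z.1 * (min d z.2 * (1 - max d z.2)) * W z.1 z.2 t =
    betaConst (α - 2) 0 *
      ∫ s in (0 : ℝ)..t, (t - s) ^ (α - 1) * -limitTerm b d W s := by
  have hlog : 0 ≤ -Real.log b := by linarith [Real.log_nonpos hb.1.le hb.2.le]
  have hsub : ∀ᶠ ε in 𝓝[>] (0 : ℝ), Icc ε (1 - ε) ×ˢ Icc ε (1 - ε) ⊆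
      Ioo (0 : ℝ) 1 ×ˢ Ioo (0 : ℝ) 1 := by
    filter_upwards [self_mem_nhdsWithin] with ε hε
    have : Icc ε (1 - ε) ⊆ Ioo (0 : ℝ) 1 := fun x hx =>
      ⟨lt_of_lt_of_le hε hx.1, by have : (0 : ℝ) < ε := hε; linarith [hx.2]⟩
    exact prod_mono this this
  have hvol : (volume : Measure (ℝ × ℝ)) (Ioo (0 : ℝ) 1 ×ˢ Ioo (0 : ℝ) 1) ≠ ⊤ := by
    rw [Measure.volume_eq_prod, Measure.prod_prod]
    simp
  have hlt : ∀ᶠ ε in 𝓝[>] (0 : ℝ), ε < 1 - ε := by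
    filter_upwards [Ioo_mem_nhdsGT (show (0 : ℝ) < 1 / 2 by norm_num)] with ε hε
    linarith [hε.2]
  -- Both sides of `rectangle_identity` pass to the limit by dominated convergence, with bounds
  -- depending on b and M but not on ε.
  have l1 : Tendsto (fun ε : ℝ => ∫ z in Icc ε (1 - ε) ×ˢ Icc ε (1 - ε),
      greenWeight ε (1 - ε) b d z * W z.1 z.2 t) (𝓝[>] 0)
      (𝓝 (∫ z in Ioo (0 : ℝ) 1 ×ˢ Ioo (0 : ℝ) 1,
        -Real.log (max b z.1) * z.1 * (min d z.2 * (1 - max d z.2)) * W z.1 z.2 t)) := by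
    refine tendsto_setIntegral_exhaustion (C := -Real.log b * 1 * M)
      (measurableSet_Ioo.prod measurableSet_Ioo) hvol
      (fun _ => measurableSet_Icc.prod measurableSet_Icc) hsub (fun z hz =>
        (eventually_mem_Icc hz.1).and (eventually_mem_Icc hz.2)) ?_ ?_ ?_
    · filter_upwards [eventually_mem_Icc hb, eventually_mem_Icc hd, self_mem_nhdsWithin]
        with ε h1 h2 hpos
      have hcont : Continuous fun z : ℝ × ℝ => W z.1 z.2 t := by fun_prop
      exact ((continuousOn_greenWeight hpos h1 h2).mul hcont.continuousOn).aestronglyMeasurable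
        (measurableSet_Icc.prod measurableSet_Icc)
    · filter_upwards [eventually_mem_Icc hb, eventually_mem_Icc hd, self_mem_nhdsWithin]
        with ε h1 h2 hpos z hz
      have hpos' : 0 < ε := hpos
      rw [abs_mul, greenWeight, abs_mul]
      exact mul_le_mul (mul_le_mul (abs_green_log_mul_le hpos' (by linarith) h1 hz.1)
        (abs_green_id_le hpos' (by linarith) h2 hz.2) (abs_nonneg _) hlog) (hM _ _ _)
        (abs_nonneg _) (by linarith)
    · intro z hz
      exact (((tendsto_green_log b z.1).mul_const z.1).mul (tendsto_green_id d z.2)).mul_const _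
  have l2 : Tendsto (fun ε : ℝ => ∫ s in (0 : ℝ)..t,
      (t - s) ^ (α - 1) * boundaryTerm ε (1 - ε) b d W s) (𝓝[>] 0)
      (𝓝 (∫ s in (0 : ℝ)..t, (t - s) ^ (α - 1) * -limitTerm b d W s)) := by
    have hk : Continuous fun s : ℝ => (t - s) ^ (α - 1) :=
      (continuous_const.sub continuous_id).rpow_const fun _ => Or.inr (by linarith)
    refine intervalIntegral.tendsto_integral_filter_of_dominated_convergence
      (fun s => |(t - s) ^ (α - 1)| * (3 * M + -Real.log b * (3 * M))) ?_ ?_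
      ((hk.abs.mul continuous_const).intervalIntegrable _ _) ?_
    · filter_upwards [eventually_mem_Icc hb, eventually_mem_Icc hd, self_mem_nhdsWithin]
        with ε h1 h2 hpos
      exact (hk.mul (continuous_boundaryTerm hpos h1 h2 hW hM)).aestronglyMeasurable
    · filter_upwards [eventually_mem_Icc hb, eventually_mem_Icc hd, self_mem_nhdsWithin, hlt]
        with ε h1 h2 hpos hlt
      have hpos' : 0 < ε := hpos
      refine Eventually.of_forall fun s _ => ?_
      rw [Real.norm_eq_abs, abs_mul]
      exact mul_le_mul_of_nonneg_left
        (abs_boundaryTerm_le hpos' (by linarith) hlt.le h1 h2 hM s) (abs_nonneg _)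
    · refine Eventually.of_forall fun s hs => ?_
      rw [uIoc_of_le ht.1.le] at hs
      have hsT : s ∈ Icc 0 T := ⟨hs.1.le, hs.2.trans ht.2.le⟩
      have m0 : (0 : ℝ) ∈ Icc (0 : ℝ) 1 := ⟨le_rfl, zero_le_one⟩
      have m1 : (1 : ℝ) ∈ Icc (0 : ℝ) 1 := ⟨zero_le_one, le_rfl⟩
      refine (tendsto_boundaryTerm hb hd hW hM (fun y hy => ?_) (fun x hx => ?_)
        (fun x hx => ?_)).const_mul _
      · have hy' := Ioo_subset_Icc_self hy
        rw [hWw 1 m1 y hy' s hsT, hw.boundary_x_one y hy' s hsT]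
      · have hx' := Ioo_subset_Icc_self hx
        rw [hWw x hx' 0 m0 s hsT, hw.boundary_y_zero x hx' s hsT]
      · have hx' := Ioo_subset_Icc_self hx
        rw [hWw x hx' 1 m1 s hsT, hw.boundary_y_one x hx' s hsT]
  refine tendsto_nhds_unique (l1.const_mul _) ((l2.const_mul _).congr' ?_)
  filter_upwards [eventually_mem_Icc hb, eventually_mem_Icc hd, self_mem_nhdsWithin, hlt]
    with ε h1 h2 hpos hlt
  have hpos' : 0 < ε := hpos
  exact (rectangle_identity hα₁ hα₂ hw hpos' (by linarith) hlt h1 h2 hW hM hWw ht).symm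

end Exhaustion

/-! ### The two kernels on the unit interval and their injectivity -/

section UnitInterval

open unitInterval

/-- A nonempty relatively open subset of [0, 1] meets (0, 1), and there contains a nonempty open
subset of the line. -/
instance isOpenPosMeasure_unitInterval : (volume : Measure I).IsOpenPosMeasure := by
  refine ⟨fun U hU ⟨x, hx⟩ h0 => ?_⟩
  obtain ⟨V, hV, rfl⟩ := isOpen_induced_iff.1 hU
  have hx' : (x : ℝ) ∈ closure (Ioo (0 : ℝ) 1) := by
    rw [closure_Ioo zero_ne_one]; exact x.2
  have hne : (V ∩ Ioo 0 1).Nonempty := mem_closure_iff.1 hx' V hV hx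
  have hpos := (hV.inter isOpen_Ioo).measure_pos volume hne
  rw [unitInterval.volume_apply] at h0
  refine hpos.ne' (measure_mono_null ?_ h0)
  rintro y ⟨hy, hy'⟩
  exact ⟨⟨y, Ioo_subset_Icc_self hy'⟩, hy, rfl⟩

theorem integral_unitInterval (f : ℝ → ℝ) : ∫ x : I, f x = ∫ x in Ioo (0 : ℝ) 1, f x := by
  rw [unitInterval.measurePreserving_coe.integral_comp unitInterval.measurableEmbedding_coe,
    ← integral_Icc_eq_integral_Ioo]

theorem integrable_unitInterval {f : ℝ → ℝ} (hf : IntegrableOn f (Icc 0 1)) :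
    Integrable (fun x : I => f x) :=
  (unitInterval.measurePreserving_coe.integrable_comp_emb
    unitInterval.measurableEmbedding_coe).2 hf

/-- A symmetric kernel whose range contains all weighted test functions is injective. -/
theorem ae_eq_zero_of_range_testFunction {k : I → I → ℝ}
    (hk : Continuous fun p : I × I => k p.1 p.2) (hs : ∀ x y, k x y = k y x) {ρ : ℝ → ℝ}
    (hρ : Continuous ρ) (hρ0 : ∀ x ∈ Ioo (0 : ℝ) 1, ρ x ≠ 0)
    (hr : ∀ φ : ℝ → ℝ, ContDiff ℝ 2 φ → tsupport φ ⊆ Ioo 0 1 →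
      ∃ ψ : I → ℝ, Integrable ψ ∧ ∀ x : I, ∫ ξ, k x ξ * ψ ξ = φ x * ρ x)
    {e : I → ℝ} (he : MemLp e 2) (h0 : ∀ᵐ x, ∫ ξ, k x ξ * e ξ = 0) : e =ᵐ[volume] 0 := by
  have hei : Integrable e := he.integrable one_le_two
  set f : ℝ → ℝ := fun x => ρ x * e (projIcc 0 1 zero_le_one x)
  have hfe : (fun x : I => f x) = fun x : I => ρ x * e x := by
    funext x; simp [f]
  have hρe : Integrable (fun x : I => ρ x * e x) := by
    have hc : Continuous fun x : I => ρ x := by fun_prop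
    obtain ⟨M, hM⟩ := isCompact_univ.exists_bound_of_continuousOn hc.continuousOn
    exact hei.bdd_mul (c := M) hc.aestronglyMeasurable (Eventually.of_forall fun x => hM x trivial)
  have hfi : IntegrableOn f (Icc 0 1) := by
    refine (unitInterval.measurePreserving_coe.integrable_comp_emb
      unitInterval.measurableEmbedding_coe).1 ?_
    change Integrable (fun x : I => f x)
    rw [hfe]; exact hρe
  have hae := isOpen_Ioo.ae_eq_zero_of_integral_contDiff_smul_eq_zero (f := f) (μ := volume)
    (hfi.mono_set Ioo_subset_Icc_self).locallyIntegrableOn (U := Ioo (0 : ℝ) 1) (by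
      intro φ hφ _ hsupp
      obtain ⟨ψ, hψ, hψk⟩ := hr φ (contDiff_infty.1 hφ 2) hsupp
      have e1 : ∫ x, φ x • f x = ∫ x in Ioo (0 : ℝ) 1, φ x • f x := by
        refine (setIntegral_eq_integral_of_forall_compl_eq_zero fun x hx => ?_).symm
        rw [image_eq_zero_of_notMem_tsupport fun h => hx (hsupp h), zero_smul]
      -- With φ ρ = K ψ, symmetry gives ∫ φ ρ e = ∫ e K ψ = ∫ ψ K e = 0, so ρ e is orthogonal to
      -- every test function.
      have hpt : ∀ x : I, φ x • f x = e x * ∫ ξ, k x ξ * ψ ξ := fun x => by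
        rw [hψk, congrFun hfe x, smul_eq_mul]; ring
      rw [e1, ← integral_unitInterval]
      simp_rw [hpt]
      rw [integral_kernel_comm hk hs hψ hei]
      refine integral_eq_zero_of_ae ?_
      filter_upwards [h0] with x hx
      simp [hx])
  have h1 : ∀ᵐ x : I, (x : ℝ) ∈ Ioo (0 : ℝ) 1 → f x = 0 :=
    unitInterval.measurePreserving_coe.quasiMeasurePreserving.ae (ae_restrict_of_ae hae)
  have h2 : ∀ᵐ x : I, x ≠ 0 ∧ x ≠ 1 := by
    rw [eventually_and]
    exact ⟨Measure.ae_ne volume 0, Measure.ae_ne volume 1⟩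
  filter_upwards [h1, h2] with x hx hx'
  have hmem : (x : ℝ) ∈ Ioo (0 : ℝ) 1 :=
    ⟨lt_of_le_of_ne x.2.1 fun h => hx'.1 (Subtype.ext h.symm),
      lt_of_le_of_ne x.2.2 fun h => hx'.2 (Subtype.ext h)⟩
  have := hx hmem
  rw [congrFun hfe x] at this
  exact (mul_eq_zero.1 this).resolve_left (hρ0 x hmem)

/-- The symmetrized Green function of `(1/x) (x u')'`, bounded at `0` and vanishing at `1`. -/
noncomputable def besselKernel (x ξ : ℝ) : ℝ := √x * √ξ * -Real.log (max x ξ)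

/-- The Green function of `u''` with Dirichlet conditions on `[0, 1]`. -/
noncomputable def dirichletKernel (y η : ℝ) : ℝ := min y η * (1 - max y η)

theorem besselKernel_comm (x ξ : ℝ) : besselKernel x ξ = besselKernel ξ x := by
  rw [besselKernel, besselKernel, max_comm, mul_comm √x]

theorem dirichletKernel_comm (x ξ : ℝ) : dirichletKernel x ξ = dirichletKernel ξ x := by
  rw [dirichletKernel, dirichletKernel, max_comm, min_comm]

theorem continuous_dirichletKernel :
    Continuous fun p : ℝ × ℝ => dirichletKernel p.1 p.2 := by
  unfold dirichletKernel; fun_prop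

/-- The product √x √ξ is at most max x ξ when both are nonnegative and is 0 otherwise. As m log m
tends to 0 with m, this gives continuity where the logarithm is singular. -/
theorem abs_besselKernel_le (x ξ : ℝ) :
    |besselKernel x ξ| ≤ |max x ξ * Real.log (max x ξ)| := by
  rw [besselKernel, abs_mul, abs_neg, abs_mul (max x ξ)]
  refine mul_le_mul_of_nonneg_right ?_ (abs_nonneg _)
  rw [abs_of_nonneg (show 0 ≤ √x * √ξ by positivity)]
  rcases le_total x 0 with hx | hx
  · rw [Real.sqrt_eq_zero_of_nonpos hx, zero_mul]; exact abs_nonneg _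
  rcases le_total ξ 0 with hξ | hξ
  · rw [Real.sqrt_eq_zero_of_nonpos hξ, mul_zero]; exact abs_nonneg _
  rw [abs_of_nonneg (hx.trans (le_max_left _ _))]
  calc √x * √ξ ≤ √(max x ξ) * √(max x ξ) := by
        gcongr
        · exact le_max_left _ _
        · exact le_max_right _ _
    _ = max x ξ := Real.mul_self_sqrt (hx.trans (le_max_left _ _))

theorem continuous_besselKernel : Continuous fun p : ℝ × ℝ => besselKernel p.1 p.2 := by
  rw [continuous_iff_continuousAt]
  intro p
  by_cases hp : max p.1 p.2 = 0
  · have h0 : besselKernel p.1 p.2 = 0 := by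
      have := abs_besselKernel_le p.1 p.2
      rw [hp, zero_mul, abs_zero] at this
      exact abs_nonpos_iff.1 this
    have hc : Continuous fun p : ℝ × ℝ => |max p.1 p.2 * Real.log (max p.1 p.2)| :=
      (Real.continuous_mul_log.comp (by fun_prop : Continuous fun p : ℝ × ℝ => max p.1 p.2)).abs
    have hl := hc.tendsto p
    rw [hp, zero_mul, abs_zero] at hl
    rw [ContinuousAt, h0]
    exact squeeze_zero_norm (fun q => abs_besselKernel_le q.1 q.2) hl
  · unfold besselKernel
    exact ((by fun_prop : ContinuousAt (fun p : ℝ × ℝ => √p.1 * √p.2) p)).mul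
      (ContinuousAt.log (f := fun p : ℝ × ℝ => max p.1 p.2) (by fun_prop) hp).neg

theorem eq_zero_of_tsupport_subset {φ : ℝ → ℝ} {U : Set ℝ} (h : tsupport φ ⊆ U) {x : ℝ}
    (hx : x ∉ U) : φ x = 0 := image_eq_zero_of_notMem_tsupport fun h' => hx (h h')

/-- The preimage of φ is -φ'': the Green representation has no end terms, since φ vanishes at 0 and
1. -/
theorem range_dirichletKernel {φ : ℝ → ℝ} (hφ : ContDiff ℝ 2 φ) (hs : tsupport φ ⊆ Ioo 0 1) :
    ∃ ψ : I → ℝ, Integrable ψ ∧ ∀ x : I, ∫ ξ : I, dirichletKernel x ξ * ψ ξ = φ x * 1 := by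
  have hd : ContDiff ℝ 1 (deriv φ) := hφ.deriv'
  have hc : Continuous (deriv (deriv φ)) := hd.continuous_deriv_one
  refine ⟨fun ξ => -deriv (deriv φ) ξ, integrable_unitInterval (f := fun ξ => -deriv (deriv φ) ξ)
    (hc.neg.continuousOn.integrableOn_compact isCompact_Icc), fun x => ?_⟩
  rw [integral_unitInterval (fun ξ => dirichletKernel x ξ * -deriv (deriv φ) ξ)]
  have h := integral_green_mul (S := id) (S' := fun _ => 1) (m := deriv φ) (m' := deriv (deriv φ))
    (w := φ) x.2.1 x.2.2 (by simp) (fun ξ _ => hasDerivAt_id ξ)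
    (fun ξ _ => (hd.differentiable one_ne_zero ξ).hasDerivAt) hc.continuousOn
    (fun ξ _ => by rw [one_mul]; exact (hφ.differentiable two_ne_zero ξ).hasDerivAt)
  rw [eq_zero_of_tsupport_subset hs (x := 0) (by simp),
    eq_zero_of_tsupport_subset hs (x := 1) (by simp), mul_zero, mul_zero, add_zero, add_zero,
    intervalIntegral.integral_of_le zero_le_one, integral_Ioc_eq_integral_Ioo] at h
  simp_rw [mul_neg]
  rw [integral_neg, mul_one, ← neg_eq_iff_eq_neg.2 h]
  simp [green, dirichletKernel]

/-- The preimage is -(ξ φ')' / √ξ, where the division cancels the factor √ξ of the kernel. As log is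
singular at 0, integration by parts is done directly: below the pole the logarithm is the constant
log b, and the terms log b · b φ'(b) from the two sides cancel. -/
theorem range_besselKernel {φ : ℝ → ℝ} (hφ : ContDiff ℝ 2 φ) (hs : tsupport φ ⊆ Ioo 0 1) :
    ∃ ψ : I → ℝ, Integrable ψ ∧ ∀ x : I, ∫ ξ : I, besselKernel x ξ * ψ ξ = φ x * √x := by
  have hd : ContDiff ℝ 1 (deriv φ) := hφ.deriv'
  have hc : Continuous (deriv (deriv φ)) := hd.continuous_deriv_one
  have hc1 : Continuous (deriv φ) := hd.continuous
  set m' : ℝ → ℝ := fun ξ => 1 * deriv φ ξ + ξ * deriv (deriv φ) ξ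
  have hm' : Continuous m' := by fun_prop
  have hm : ∀ ξ, HasDerivAt (fun ξ => ξ * deriv φ ξ) (m' ξ) ξ := fun ξ =>
    (hasDerivAt_id ξ).mul (hd.differentiable one_ne_zero ξ).hasDerivAt
  have hφd : ∀ ξ, HasDerivAt φ (deriv φ ξ) ξ := fun ξ =>
    (hφ.differentiable two_ne_zero ξ).hasDerivAt
  have hφ1 : φ 1 = 0 := eq_zero_of_tsupport_subset hs (by simp)
  refine ⟨fun ξ => -m' ξ * (√(ξ : ℝ))⁻¹, integrable_unitInterval (f := fun ξ => -m' ξ * (√ξ)⁻¹) ?_,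
    fun x => ?_⟩
  · rw [← intervalIntegrable_iff_integrableOn_Icc_of_le zero_le_one]
    have h1 := intervalIntegral.intervalIntegrable_rpow' (r := -(1 / 2)) (a := 0) (b := 1)
      (by norm_num)
    have h2 : IntervalIntegrable (fun ξ : ℝ => (√ξ)⁻¹) volume 0 1 := by
      refine h1.congr fun ξ hξ => ?_
      rw [uIoc_of_le zero_le_one] at hξ
      rw [Real.sqrt_eq_rpow, Real.rpow_neg hξ.1.le]
    exact h2.continuousOn_mul hm'.neg.continuousOn
  rw [integral_unitInterval (fun ξ => besselKernel x ξ * (-m' ξ * (√ξ)⁻¹))]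
  rcases x.2.1.eq_or_lt with hx | hx
  · rw [← hx]; simp [besselKernel]
  set b : ℝ := (x : ℝ)
  have hb1 : b ≤ 1 := x.2.2
  have hcl : ContinuousOn Real.log (Icc b 1) := continuousOn_log_Icc hx
  have hsub : uIcc b 1 ⊆ Icc b 1 := by rw [uIcc_of_le hb1]
  have i2 : IntervalIntegrable (fun ξ => Real.log ξ * m' ξ) volume b 1 :=
    ((hcl.mono hsub).mul hm'.continuousOn).intervalIntegrable
  have v1 : ∫ ξ in (0 : ℝ)..b, Real.log (max b ξ) * m' ξ = Real.log b * (b * deriv φ b) := by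
    rw [intervalIntegral.integral_congr (g := fun ξ => Real.log b * m' ξ) fun ξ hξ => by
      rw [uIcc_of_le hx.le] at hξ; simp only [max_eq_left hξ.2],
      intervalIntegral.integral_const_mul,
      intervalIntegral.integral_eq_sub_of_hasDerivAt (fun ξ _ => hm ξ)
        (hm'.intervalIntegrable _ _)]
    simp
  have v2 : ∫ ξ in b..1, Real.log (max b ξ) * m' ξ = φ b - Real.log b * (b * deriv φ b) := by
    rw [intervalIntegral.integral_congr (g := fun ξ => Real.log ξ * m' ξ) fun ξ hξ => by
      rw [uIcc_of_le hb1] at hξ; simp only [max_eq_right hξ.1],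
      intervalIntegral.integral_eq_sub_of_hasDerivAt
        (f := fun ξ => Real.log ξ * (ξ * deriv φ ξ) - φ ξ) (fun ξ hξ => ?_) i2]
    · rw [hφ1]; simp
    · have hξ0 : ξ ≠ 0 := (hx.trans_le (hsub hξ).1).ne'
      exact (((Real.hasDerivAt_log hξ0).mul (hm ξ)).sub (hφd ξ)).congr_deriv (by
        field_simp; ring)
  have hcm : Continuous fun ξ => Real.log (max b ξ) * m' ξ :=
    (Continuous.log (by fun_prop) fun ξ => (hx.trans_le (le_max_left _ _)).ne').mul hm'
  have v := intervalIntegral.integral_add_adjacent_intervals (hcm.intervalIntegrable 0 b)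
    (hcm.intervalIntegrable b 1) (μ := volume)
  rw [v1, v2, add_sub_cancel, intervalIntegral.integral_of_le zero_le_one,
    integral_Ioc_eq_integral_Ioo] at v
  rw [v, ← integral_mul_const]
  refine setIntegral_congr_fun measurableSet_Ioo fun ξ hξ => ?_
  have : √ξ ≠ 0 := (Real.sqrt_pos.2 hξ.1).ne'
  simp only [besselKernel]
  field_simp

end UnitInterval

/-! ### The kernel equation and the conclusion -/

section Uniqueness

open unitInterval

variable {α T : ℝ} {w : ℝ → ℝ → ℝ → ℝ}

/-- The kernel form of the equation for `√x u`. -/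
theorem kernel_identity (hα₁ : 1 < α) (hα₂ : α < 2)
    (hw : IsContinuousSolution α T (fun _ _ _ => 0) (fun _ _ => 0) (fun _ _ => 0) w)
    {W : ℝ → ℝ → ℝ → ℝ} {M : ℝ} (hW : Continuous fun p : ℝ × ℝ × ℝ => W p.1 p.2.1 p.2.2)
    (hM : ∀ x y t, |W x y t| ≤ M)
    (hWw : ∀ x ∈ Icc (0 : ℝ) 1, ∀ y ∈ Icc (0 : ℝ) 1, ∀ t ∈ Icc 0 T, W x y t = w x y t)
    {C : ℝ} (hC : C = -(betaConst (α - 2) 0 /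
      (1 / Real.Gamma (2 - α) * betaConst (α - 2) (1 - α)))) (x y : I)
    {t : ℝ} (ht : t ∈ Ioo 0 T) :
    ∫ ξ : I, besselKernel x ξ * ∫ η : I, dirichletKernel y η * (√(ξ : ℝ) * W ξ η t) =
      C * ∫ s in (0 : ℝ)..t, (t - s) ^ (α - 1) *
        ((∫ η : I, dirichletKernel y η * (√(x : ℝ) * W x η s)) +
          ∫ ξ : I, besselKernel x ξ * (√(ξ : ℝ) * W ξ y s)) := by
  have hsT : ∀ s ∈ uIcc 0 t, s ∈ Icc 0 T := fun s hs => by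
    rw [uIcc_of_le ht.1.le] at hs
    exact ⟨hs.1, hs.2.trans ht.2.le⟩
  -- `square_identity` covers interior points only. On the sides of the square a kernel and the
  -- matching values of √x W vanish, so both sides of the identity are 0.
  have hzero : (∀ ξ : I, besselKernel x ξ = 0) → (∀ s ∈ uIcc 0 t, ∀ η : I, √(x : ℝ) * W x η s = 0) →
      ∫ ξ : I, besselKernel x ξ * ∫ η : I, dirichletKernel y η * (√(ξ : ℝ) * W ξ η t) =
      C * ∫ s in (0 : ℝ)..t, (t - s) ^ (α - 1) *
        ((∫ η : I, dirichletKernel y η * (√(x : ℝ) * W x η s)) +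
          ∫ ξ : I, besselKernel x ξ * (√(ξ : ℝ) * W ξ y s)) := by
    intro h1 h2
    rw [intervalIntegral.integral_congr (g := fun _ => 0) fun s hs => by
      simp only [h1, h2 s hs, mul_zero, zero_mul, integral_zero, add_zero]]
    simp [h1]
  have hzero' : (∀ η : I, dirichletKernel y η = 0) → (∀ s ∈ uIcc 0 t, ∀ ξ : I, W ξ y s = 0) →
      ∫ ξ : I, besselKernel x ξ * ∫ η : I, dirichletKernel y η * (√(ξ : ℝ) * W ξ η t) =
      C * ∫ s in (0 : ℝ)..t, (t - s) ^ (α - 1) *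
        ((∫ η : I, dirichletKernel y η * (√(x : ℝ) * W x η s)) +
          ∫ ξ : I, besselKernel x ξ * (√(ξ : ℝ) * W ξ y s)) := by
    intro h1 h2
    rw [intervalIntegral.integral_congr (g := fun _ => 0) fun s hs => by
      simp only [h1, h2 s hs, mul_zero, zero_mul, integral_zero, add_zero]]
    simp [h1]
  have m0 : (0 : ℝ) ∈ Icc (0 : ℝ) 1 := ⟨le_rfl, zero_le_one⟩
  have m1 : (1 : ℝ) ∈ Icc (0 : ℝ) 1 := ⟨zero_le_one, le_rfl⟩
  rcases x.2.1.eq_or_lt with hx0 | hx0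
  · exact hzero (fun ξ => by simp [besselKernel, ← hx0]) fun s _ η => by simp [← hx0]
  rcases x.2.2.eq_or_lt with hx1 | hx1
  · refine hzero (fun ξ => by simp [besselKernel, hx1, max_eq_left ξ.2.2]) fun s hs η => ?_
    rw [hx1, hWw 1 m1 η η.2 s (hsT s hs), hw.boundary_x_one η η.2 s (hsT s hs), mul_zero]
  rcases y.2.1.eq_or_lt with hy0 | hy0
  · refine hzero' (fun η => by simp [dirichletKernel, ← hy0, min_eq_left η.2.1]) fun s hs ξ => ?_
    rw [← hy0, hWw ξ ξ.2 0 m0 s (hsT s hs), hw.boundary_y_zero ξ ξ.2 s (hsT s hs)]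
  rcases y.2.2.eq_or_lt with hy1 | hy1
  · refine hzero' (fun η => by simp [dirichletKernel, hy1, max_eq_left η.2.2]) fun s hs ξ => ?_
    rw [hy1, hWw ξ ξ.2 1 m1 s (hsT s hs), hw.boundary_y_one ξ ξ.2 s (hsT s hs)]
  have h := square_identity hα₁ hα₂ hw ⟨hx0, hx1⟩ ⟨hy0, hy1⟩ hW hM hWw ht
  have hA : 1 / Real.Gamma (2 - α) * betaConst (α - 2) (1 - α) ≠ 0 :=
    mul_ne_zero (one_div_ne_zero (Real.Gamma_pos_of_pos (by linarith)).ne')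
      (betaConst_pos (by linarith) (by linarith)).ne'
  have hQ : ∀ ξ s : ℝ, ∫ η : I, dirichletKernel y η * (√ξ * W ξ η s) =
      √ξ * ∫ η in Ioo (0 : ℝ) 1, dirichletKernel y η * W ξ η s := fun ξ s => by
    rw [integral_unitInterval (fun η => dirichletKernel y η * (√ξ * W ξ η s)),
      ← integral_const_mul]
    simp_rw [mul_left_comm]
  -- The √ξ in the symmetrized kernel and the √ξ in ω multiply to the weight ξ.
  have hP : ∀ g : ℝ → ℝ, ∫ ξ : I, besselKernel x ξ * (√(ξ : ℝ) * g ξ) =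
      √(x : ℝ) * ∫ ξ in Ioo (0 : ℝ) 1, -Real.log (max x ξ) * ξ * g ξ := fun g => by
    rw [integral_unitInterval (fun ξ => besselKernel x ξ * (√ξ * g ξ)), ← integral_const_mul]
    refine setIntegral_congr_fun measurableSet_Ioo fun ξ hξ => ?_
    simp only [besselKernel]
    linear_combination (√(x : ℝ) * -Real.log (max x ξ) * g ξ) * Real.mul_self_sqrt hξ.1.le
  have hbr : ∀ s, (∫ η : I, dirichletKernel y η * (√(x : ℝ) * W x η s)) +
      ∫ ξ : I, besselKernel x ξ * (√(ξ : ℝ) * W ξ y s) = √(x : ℝ) * limitTerm x y W s := fun s => by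
    rw [hQ, hP fun ξ => W ξ y s, ← mul_add]; rfl
  have hprod : ∫ z in Ioo (0 : ℝ) 1 ×ˢ Ioo (0 : ℝ) 1,
        -Real.log (max x z.1) * z.1 * (min (y : ℝ) z.2 * (1 - max (y : ℝ) z.2)) * W z.1 z.2 t =
      ∫ ξ in Ioo (0 : ℝ) 1, -Real.log (max x ξ) * ξ *
        ∫ η in Ioo (0 : ℝ) 1, dirichletKernel y η * W ξ η t := by
    have hc : Continuous fun z : ℝ × ℝ =>
        -Real.log (max x z.1) * z.1 * (min (y : ℝ) z.2 * (1 - max (y : ℝ) z.2)) * W z.1 z.2 t := by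
      have : Continuous fun z : ℝ × ℝ => Real.log (max x z.1) :=
        Continuous.log (by fun_prop) fun z => (hx0.trans_le (le_max_left _ _)).ne'
      fun_prop
    rw [Measure.volume_eq_prod, setIntegral_prod]
    · simp_rw [← integral_const_mul, dirichletKernel, mul_assoc]
    · exact (hc.continuousOn.integrableOn_compact (isCompact_Icc.prod isCompact_Icc)).mono_set
        (prod_mono Ioo_subset_Icc_self Ioo_subset_Icc_self)
  simp_rw [hbr, hQ, mul_left_comm _ (√(x : ℝ))]
  rw [hP fun ξ => ∫ η in Ioo (0 : ℝ) 1, dirichletKernel y η * W ξ η t, ← hprod,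
    intervalIntegral.integral_const_mul, mul_left_comm C]
  congr 1
  simp_rw [mul_neg, intervalIntegral.integral_neg] at h
  generalize 1 / Real.Gamma (2 - α) * betaConst (α - 2) (1 - α) = A at hA h hC
  rw [hC, ← mul_right_inj' hA, h]
  field_simp

/-- The homogeneous problem has only the zero solution. -/
theorem eq_zero_of_homogeneous (hα₁ : 1 < α) (hα₂ : α < 2) (hT : 0 < T)
    (hw : IsContinuousSolution α T (fun _ _ _ => 0) (fun _ _ => 0) (fun _ _ => 0) w) :
    ∀ x ∈ Icc (0 : ℝ) 1, ∀ y ∈ Icc (0 : ℝ) 1, ∀ t ∈ Icc 0 T, w x y t = 0 := by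
  -- Clamping the arguments extends w to a bounded continuous function on the whole space that
  -- agrees with it on the closed domain.
  set W : ℝ → ℝ → ℝ → ℝ := fun x y t => w (projIcc 0 1 zero_le_one x) (projIcc 0 1 zero_le_one y)
    (projIcc 0 T hT.le t)
  have hWw : ∀ x ∈ Icc (0 : ℝ) 1, ∀ y ∈ Icc (0 : ℝ) 1, ∀ t ∈ Icc 0 T, W x y t = w x y t := by
    intro x hx y hy t ht
    simp only [W, projIcc_of_mem _ hx, projIcc_of_mem _ hy, projIcc_of_mem _ ht]
  have hmem : ∀ p : ℝ × ℝ × ℝ, ((projIcc 0 1 zero_le_one p.1 : ℝ), (projIcc 0 1 zero_le_one p.2.1 : ℝ),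
      (projIcc 0 T hT.le p.2.2 : ℝ)) ∈ Omega T := fun p =>
    ⟨(projIcc 0 1 zero_le_one p.1).2, (projIcc 0 1 zero_le_one p.2.1).2,
      (projIcc 0 T hT.le p.2.2).2⟩
  have hW : Continuous fun p : ℝ × ℝ × ℝ => W p.1 p.2.1 p.2.2 := by
    have hc1 : Continuous (projIcc (0 : ℝ) 1 zero_le_one) := continuous_projIcc
    have hc2 : Continuous (projIcc (0 : ℝ) T hT.le) := continuous_projIcc
    exact hw.continuousOn.comp_continuous (by fun_prop) hmem
  have hcomp : IsCompact (Omega T) := isCompact_Icc.prod (isCompact_Icc.prod isCompact_Icc)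
  obtain ⟨M, hM⟩ := hcomp.exists_bound_of_continuousOn hw.continuousOn
  have hM' : ∀ x y t, |W x y t| ≤ M := fun x y t => hM _ (hmem (x, y, t))
  have key := eq_zero_of_kernel_identity (X := I) (Y := I) (μ := volume) (ν := volume)
    (P := fun x ξ => besselKernel x ξ) (Q := fun y η => dirichletKernel y η)
    (T := T) (β := α - 1) (M := M) (ω := fun x y t => √(x : ℝ) * W x y t)
    (continuous_besselKernel.comp (by fun_prop : Continuous fun p : I × I => ((p.1 : ℝ), (p.2 : ℝ))))
    (fun x ξ => besselKernel_comm x ξ)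
    (fun e he h0 => ae_eq_zero_of_range_testFunction (k := fun x ξ => besselKernel x ξ)
      (continuous_besselKernel.comp
        (by fun_prop : Continuous fun p : I × I => ((p.1 : ℝ), (p.2 : ℝ))))
      (fun x ξ => besselKernel_comm x ξ) Real.continuous_sqrt
      (fun x hx => (Real.sqrt_pos.2 hx.1).ne') (fun φ => range_besselKernel) he h0)
    (continuous_dirichletKernel.comp
      (by fun_prop : Continuous fun p : I × I => ((p.1 : ℝ), (p.2 : ℝ))))
    (fun x ξ => dirichletKernel_comm x ξ)
    (fun e he h0 => ae_eq_zero_of_range_testFunction (k := fun x ξ => dirichletKernel x ξ)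
      (continuous_dirichletKernel.comp
        (by fun_prop : Continuous fun p : I × I => ((p.1 : ℝ), (p.2 : ℝ))))
      (fun x ξ => dirichletKernel_comm x ξ) (continuous_const (y := (1 : ℝ)))
      (fun x hx => one_ne_zero) (fun φ => range_dirichletKernel) he h0)
    (by linarith) (by fun_prop)
    (fun x y t => by
      rw [abs_mul, abs_of_nonneg (Real.sqrt_nonneg _)]
      exact (mul_le_of_le_one_left (abs_nonneg _) (Real.sqrt_le_one.2 x.2.2)).trans (hM' _ _ _))
    (fun x y t ht => kernel_identity hα₁ hα₂ hw hW hM' hWw rfl x y ht)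
  have hint : ∀ p ∈ Ioo (0 : ℝ) 1 ×ˢ Ioo (0 : ℝ) 1 ×ˢ Ioo 0 T, w p.1 p.2.1 p.2.2 = 0 := by
    rintro ⟨x, y, t⟩ ⟨hx, hy, ht⟩
    have hx' := Ioo_subset_Icc_self hx
    have hy' := Ioo_subset_Icc_self hy
    have h := key t ht ⟨x, hx'⟩ ⟨y, hy'⟩
    have h' := (mul_eq_zero.1 h).resolve_left (Real.sqrt_pos.2 hx.1).ne'
    rwa [hWw x hx' y hy' t (Ioo_subset_Icc_self ht)] at h'
  intro x hx y hy t ht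
  -- Vanishing of √x w gives w = 0 only for x > 0, and the kernel equation only covers 0 < t < T;
  -- density and continuity reach the closed domain.
  have hcl : closure (Ioo (0 : ℝ) 1 ×ˢ Ioo (0 : ℝ) 1 ×ˢ Ioo 0 T) = Omega T := by
    rw [closure_prod_eq, closure_prod_eq, closure_Ioo zero_ne_one, closure_Ioo hT.ne, Omega]
  refine closure_minimal (s := Ioo (0 : ℝ) 1 ×ˢ Ioo (0 : ℝ) 1 ×ˢ Ioo 0 T)
    (t := {p : ℝ × ℝ × ℝ | W p.1 p.2.1 p.2.2 = 0}) ?_ (isClosed_eq hW continuous_const)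
    (hcl.ge (⟨hx, hy, ht⟩ : (x, y, t) ∈ Omega T)) |> (hWw x hx y hy t ht).symm.trans
  rintro ⟨x, y, t⟩ ⟨hx, hy, ht⟩
  exact (hWw x (Ioo_subset_Icc_self hx) y (Ioo_subset_Icc_self hy) t
    (Ioo_subset_Icc_self ht)).trans (hint (x, y, t) ⟨hx, hy, ht⟩)

end Uniqueness

end FractionalWave

theorem mainTheorem2 (α T : ℝ) (hα₁ : 1 < α) (hα₂ : α < 2) (hT : 0 < T)
    (f : ℝ → ℝ → ℝ → ℝ) (φ ψ : ℝ → ℝ → ℝ) (u v : ℝ → ℝ → ℝ → ℝ)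
    (hu : FractionalWave.IsContinuousSolution α T f φ ψ u)
    (hv : FractionalWave.IsContinuousSolution α T f φ ψ v) :
    ∀ x ∈ Set.Icc (0 : ℝ) 1, ∀ y ∈ Set.Icc (0 : ℝ) 1, ∀ t ∈ Set.Icc 0 T,
      u x y t = v x y t := by
  intro x hx y hy t ht
  exact sub_eq_zero.1
    (FractionalWave.eq_zero_of_homogeneous hα₁ hα₂ hT (hu.sub hT hv) x hx y hy t ht)
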